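/- For a discrete group $G$, a normed $G$-module is a real normed space $V$ with an action of $G$ by linear isometries. A dual normed $G$-module is the topological dual $V = W' = \mathcal{B}(W,\mathbb{R})$ of a normed $G$-module $W$, with the operator norm and the action $(g\cdot f)(w) = f(g^{-1}w)$. The bounded cohomology $H^\bullet_b(G;V)$ is the cohomology of the cochain complex $(\ell^\infty(G^n,V))_{n\ge 0}$ of bounded functions $G^n \to V$ with coboundary $$\delta^n(f)(g_1,\dots,g_{n+1}) = g_1\cdot f(g_2,\dots,g_{n+1}) + \sum_{j=1}^{n}(-1)^j f(g_1,\dots,g_jg_{j+1},\dots,g_{n+1}) + (-1)^{n+1} f(g_1,\dots,g_n).$$ For a homomorphism $\varphi\colon\Gamma\to K$ and a normed $K$-module $V$, $\varphi^{-1}V$ denotes $V$ regarded as a $\Gamma$-module through $\varphi$, and $H^i_b(\varphi;V)\colon H^i_b(K;V)\to H^i_b(\Gamma;\varphi^{-1}V)$ is induced by precomposition of cochains with $\varphi$. A normed $G$-module $U$ is relatively injective if for all bounded $G$-linear maps $\iota\colon A\to B$ and $\alpha\colon A\to U$ of normed $G$-modules such that $\iota$ has a (not necessarily $G$-linear) linear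 left inverse $\sigma\colon B\to A$ with $\|\sigma\|\le 1$, there is a bounded $G$-linear map $\beta\colon B\to U$ with $\beta\circ\iota=\alpha$ and $\|\beta\|\le\|\alpha\|$. A group $G$ is boundedly $n$-acyclic if $H^i_b(G;\mathbb{R})=0$ (trivial action on $\mathbb{R}$) for all integers $i$ with $1\le i\le n$. Theorem. Let $\varphi\colon\Gamma\to K$ be a homomorphism of discrete groups with kernel $H$, and let $n\ge 0$ be an integer or $n=\infty$. Then the following are equivalent: (1) For every dual normed $K$-module $V$, the restriction map $H^i_b(\varphi;V)\colon H^i_b(K;V)\to H^i_b(\Gamma;\varphi^{-1}V)$ is an isomorphism for all integers $0\le i\le n$ and, if $n<\infty$, injective for $i=n+1$. (2) For every dual normed $K$-module $V$, the restriction map $H^i_b(\varphi;V)$ is surjective for all integers $0\le i\le n$. (3) $\varphi$ is surjective, and $H^i_b(\Gamma;\varphi^{-1}V)=0$ for all integers $1\le i\le n$ and every relatively injective dual normed $K$-module $V$. (4) $\varphi$ is surjective, and $H$ is a boundedly $n$-acyclic group. -/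

import Mathlib

universe u v w

namespace BoundedCohomology

noncomputable section

/-- The structure of a normed `G`-module on a normed space `V`: an action of the discrete group `G`
on `V` by linear isometries. -/
abbrev NormedAction (G : Type u) [Group G] (V : Type w) [NormedAddCommGroup V] [NormedSpace ℝ V] :=
  G →* (V ≃ₗᵢ[ℝ] V)

/-- The action on the topological dual of a normed `G`-module, `(g • f) x = f (g⁻¹ • x)`.
The modules of this form are the dual normed `G`-modules. -/
def dualAction {G : Type u} [Group G] {W : Type w} [NormedAddCommGroup W] [NormedSpace ℝ W]
    (ρ : NormedAction G W) : NormedAction G (StrongDual ℝ W) where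
  toFun g :=
    { toFun := fun f => f.comp (ρ g⁻¹ : W →L[ℝ] W)
      invFun := fun f => f.comp (ρ g : W →L[ℝ] W)
      map_add' := fun _ _ => rfl
      map_smul' := fun _ _ => rfl
      left_inv := fun f => by
        ext x
        change f (ρ g⁻¹ (ρ g x)) = f x
        simp
      right_inv := fun f => by
        ext x
        change f (ρ g (ρ g⁻¹ x)) = f x
        simp
      norm_map' := fun f => f.opNorm_comp_linearIsometryEquiv (ρ g⁻¹) }
  map_one' := by
    ext f x
    change f (ρ 1⁻¹ x) = f x
    simp
  map_mul' g h := by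
    ext f x
    change f (ρ (g * h)⁻¹ x) = f (ρ h⁻¹ (ρ g⁻¹ x))
    simp [mul_inv_rev]

@[simp]
theorem dualAction_apply {G : Type u} [Group G] {W : Type w} [NormedAddCommGroup W]
    [NormedSpace ℝ W] (ρ : NormedAction G W) (g : G) (f : StrongDual ℝ W) (x : W) :
    dualAction ρ g f x = f (ρ g⁻¹ x) := rfl

/-- The restriction `φ⁻¹V` of a normed `K`-module `V` along `φ : Γ → K`. -/
abbrev restrict {Γ : Type u} {K : Type v} [Group Γ] [Group K] {V : Type w}
    [NormedAddCommGroup V] [NormedSpace ℝ V] (φ : Γ →* K) (ρ : NormedAction K V) :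
    NormedAction Γ V :=
  ρ.comp φ

/-- A continuous linear map between normed `G`-modules is `G`-equivariant. -/
def IsEquivariant {G : Type u} [Group G] {A : Type v} {B : Type w}
    [NormedAddCommGroup A] [NormedSpace ℝ A] [NormedAddCommGroup B] [NormedSpace ℝ B]
    (ρA : NormedAction G A) (ρB : NormedAction G B) (f : A →L[ℝ] B) : Prop :=
  ∀ (g : G) (a : A), f (ρA g a) = ρB g (f a)

/-- A normed `G`-module `U` is relatively injective if every bounded `G`-linear map `α : A → U`
extends, without increasing the norm, along every strongly injective bounded `G`-linear map
`ι : A → B` of normed `G`-modules. Here `ι` is strongly injective if it has a left inverse `σ`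
(not necessarily `G`-linear) of norm at most one. -/
def IsRelativelyInjective {G : Type v} [Group G] {U : Type w} [NormedAddCommGroup U]
    [NormedSpace ℝ U] (ρ : NormedAction G U) : Prop :=
  ∀ (A B : Type (max v w)) [NormedAddCommGroup A] [NormedSpace ℝ A]
    [NormedAddCommGroup B] [NormedSpace ℝ B]
    (ρA : NormedAction G A) (ρB : NormedAction G B)
    (ι : A →L[ℝ] B) (σ : B →L[ℝ] A) (α : A →L[ℝ] U),
    IsEquivariant ρA ρB ι → ‖σ‖ ≤ 1 → σ.comp ι = ContinuousLinearMap.id ℝ A →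
    IsEquivariant ρA ρ α →
    ∃ β : B →L[ℝ] U, IsEquivariant ρB ρ β ∧ β.comp ι = α ∧ ‖β‖ ≤ ‖α‖

/-- The bounded functions `G^n → V`, as a subspace of all functions. -/
def boundedFunctions (G : Type u) (V : Type w) [NormedAddCommGroup V] [NormedSpace ℝ V] (n : ℕ) :
    Submodule ℝ ((Fin n → G) → V) where
  carrier := {f | ∃ C : ℝ, ∀ x, ‖f x‖ ≤ C}
  zero_mem' := ⟨0, fun x => by simp⟩
  add_mem' := by
    rintro f g ⟨C, hC⟩ ⟨D, hD⟩
    exact ⟨C + D, fun x => (norm_add_le _ _).trans (add_le_add (hC x) (hD x))⟩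
  smul_mem' := by
    rintro c f ⟨C, hC⟩
    refine ⟨‖c‖ * C, fun x => ?_⟩
    rw [Pi.smul_apply, norm_smul]
    exact mul_le_mul_of_nonneg_left (hC x) (norm_nonneg c)

/-- The space `ℓ^∞(G^n, V)` of bounded inhomogeneous `n`-cochains. -/
def Cochain (G : Type u) (V : Type w) [NormedAddCommGroup V] [NormedSpace ℝ V] (n : ℕ) :
    Type (max u w) :=
  boundedFunctions G V n

instance (G : Type u) (V : Type w) [NormedAddCommGroup V] [NormedSpace ℝ V] (n : ℕ) :
    AddCommGroup (Cochain G V n) :=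
  inferInstanceAs (AddCommGroup (boundedFunctions G V n))

instance (G : Type u) (V : Type w) [NormedAddCommGroup V] [NormedSpace ℝ V] (n : ℕ) :
    Module ℝ (Cochain G V n) :=
  inferInstanceAs (Module ℝ (boundedFunctions G V n))

instance (G : Type u) (V : Type w) [NormedAddCommGroup V] [NormedSpace ℝ V] (n : ℕ) :
    CoeFun (Cochain G V n) (fun _ => (Fin n → G) → V) :=
  ⟨fun f => f.1⟩

section CochainLemmas

variable {G : Type u} {V : Type w} [NormedAddCommGroup V] [NormedSpace ℝ V] {n : ℕ}

@[ext]
theorem Cochain.ext {f g : Cochain G V n} (h : ∀ x, f x = g x) : f = g :=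
  Subtype.ext (funext h)

@[simp]
theorem Cochain.add_apply (f g : Cochain G V n) (x : Fin n → G) : (f + g) x = f x + g x := rfl

@[simp]
theorem Cochain.smul_apply (c : ℝ) (f : Cochain G V n) (x : Fin n → G) :
    (c • f) x = c • f x := rfl

end CochainLemmas

section Complex

variable {G : Type u} [Group G] {V : Type w} [NormedAddCommGroup V] [NormedSpace ℝ V]

/-- The coboundary operator `δ^n : ℓ^∞(G^n, V) → ℓ^∞(G^(n+1), V)`,
`(δ^n f)(g_1, …, g_{n+1}) = g_1 • f(g_2, …, g_{n+1})
  + ∑_{1 ≤ i ≤ n} (-1)^i f(g_1, …, g_i g_{i+1}, …, g_{n+1}) + (-1)^(n+1) f(g_1, …, g_n)`.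
The last summand of the sum below (index `j = n`) is the last term of this formula. -/
def delta (ρ : NormedAction G V) (n : ℕ) : Cochain G V n →ₗ[ℝ] Cochain G V (n + 1) where
  toFun f := ⟨fun g => ρ (g 0) (f fun i => g i.succ) +
      ∑ j : Fin (n + 1), (-1 : ℝ) ^ ((j : ℕ) + 1) • f (Fin.contractNth j (· * ·) g), by
    obtain ⟨C, hC⟩ := f.2
    refine ⟨C + ∑ _j : Fin (n + 1), C, fun g => (norm_add_le _ _).trans (add_le_add ?_ ?_)⟩
    · rw [LinearIsometryEquiv.norm_map]
      exact hC _
    · refine (norm_sum_le _ _).trans (Finset.sum_le_sum fun j _ => ?_)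
      rw [norm_smul, norm_pow, norm_neg, norm_one, one_pow, one_mul]
      exact hC _⟩
  map_add' f g := by
    ext x
    change ρ (x 0) (f _ + g _) + ∑ j : Fin (n + 1), (-1 : ℝ) ^ ((j : ℕ) + 1) • (f _ + g _) =
      (ρ (x 0) (f _) + ∑ j : Fin (n + 1), (-1 : ℝ) ^ ((j : ℕ) + 1) • f _) +
      (ρ (x 0) (g _) + ∑ j : Fin (n + 1), (-1 : ℝ) ^ ((j : ℕ) + 1) • g _)
    simp [Finset.sum_add_distrib, add_add_add_comm]
  map_smul' c f := by
    ext x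
    change ρ (x 0) (c • f _) + ∑ j : Fin (n + 1), (-1 : ℝ) ^ ((j : ℕ) + 1) • (c • f _) =
      c • (ρ (x 0) (f _) + ∑ j : Fin (n + 1), (-1 : ℝ) ^ ((j : ℕ) + 1) • f _)
    simp [Finset.smul_sum, smul_comm c]

/-- Bounded cocycles. -/
def cocycles (ρ : NormedAction G V) (n : ℕ) : Submodule ℝ (Cochain G V n) :=
  LinearMap.ker (delta ρ n)

/-- Bounded coboundaries; these are the coboundaries of bounded cochains. -/
def coboundaries (ρ : NormedAction G V) : (n : ℕ) → Submodule ℝ (Cochain G V n)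
  | 0 => ⊥
  | n + 1 => LinearMap.range (delta ρ n)

theorem delta_apply (ρ : NormedAction G V) (n : ℕ) (f : Cochain G V n) (g : Fin (n + 1) → G) :
    delta ρ n f g = ρ (g 0) (f fun i => g i.succ) +
      ∑ j : Fin (n + 1), (-1 : ℝ) ^ ((j : ℕ) + 1) • f (Fin.contractNth j (· * ·) g) := rfl

/-- The linear representation underlying a normed `G`-module, moved to a common universe. -/
def liftRepresentation (ρ : NormedAction G V) :
    Representation (ULift.{max u w} ℝ) (ULift.{w} G) (ULift.{u} V) where
  toFun g :=
    { toFun := fun x => ⟨ρ g.down x.down⟩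
      map_add' := fun x y => ULift.ext _ _ (map_add (ρ g.down) x.down y.down)
      map_smul' := fun c x => ULift.ext _ _ (map_smul (ρ g.down) c.down x.down) }
  map_one' := by ext x; simp
  map_mul' g h := by ext x; simp

theorem d_liftRepresentation (ρ : NormedAction G V) (n : ℕ) (f : Cochain G V n) :
    (inhomogeneousCochains.d (Rep.of (liftRepresentation ρ)) n).hom
      (fun x => ULift.up.{u} (f fun i => (x i).down)) =
    fun x => ULift.up.{u} (delta ρ n f fun i => (x i).down) := by
  funext x
  have hsum : ∀ (s : Finset (Fin (n + 1))) (F : Fin (n + 1) → ULift.{u} V),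
      (∑ j ∈ s, F j).down = ∑ j ∈ s, (F j).down := fun s F =>
    map_sum (AddEquiv.ulift : ULift.{u} V ≃+ V) F s
  apply ULift.ext
  rw [inhomogeneousCochains.d_hom_apply]
  refine congrArg₂ (· + ·) rfl ((hsum _ _).trans (Finset.sum_congr rfl fun j _ => ?_))
  have hpow : ∀ m : ℕ, ((-1 : ULift.{max u w} ℝ) ^ m).down = (-1 : ℝ) ^ m := fun m =>
    map_pow (ULift.ringEquiv : ULift.{max u w} ℝ ≃+* ℝ) (-1) m
  refine congrArg₂ (· • ·) (hpow _) (congrArg f ?_)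
  exact Fin.comp_contractNth (· * ·) (· * ·) (f := ULift.down) (fun _ _ => rfl) j x

theorem delta_delta (ρ : NormedAction G V) (n : ℕ) (f : Cochain G V n) :
    delta ρ (n + 1) (delta ρ n f) = 0 := by
  have h := congrArg (fun m => m.hom (fun x : Fin n → ULift.{w} G =>
      ULift.up.{u} (f fun i => (x i).down)))
    (groupCohomology.inhomogeneousCochains.d_comp_d n (Rep.of (liftRepresentation ρ)))
  have h1 : (inhomogeneousCochains.d (Rep.of (liftRepresentation ρ)) (n + 1)).hom
      ((inhomogeneousCochains.d (Rep.of (liftRepresentation ρ)) n).hom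
        (fun x => ULift.up.{u} (f fun i => (x i).down))) = 0 := h
  rw [d_liftRepresentation, d_liftRepresentation] at h1
  ext g
  exact congrArg ULift.down (congrFun h1 fun i => ULift.up.{w} (g i))

theorem coboundaries_le_cocycles (ρ : NormedAction G V) (n : ℕ) :
    coboundaries ρ n ≤ cocycles ρ n := by
  cases n with
  | zero => exact bot_le
  | succ n =>
    rintro _ ⟨f, rfl⟩
    exact delta_delta ρ n f

/-- The bounded cohomology `H^n_b(G; V)`. -/
abbrev Cohomology (ρ : NormedAction G V) (n : ℕ) : Type (max u w) :=
  cocycles ρ n ⧸ (coboundaries ρ n).submoduleOf (cocycles ρ n)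

end Complex

section Restriction

variable {Γ : Type u} {K : Type v} [Group Γ] [Group K] {V : Type w}
  [NormedAddCommGroup V] [NormedSpace ℝ V]

/-- Pulling back bounded cochains along `φ : Γ → K`. -/
def cochainMap (φ : Γ →* K) (n : ℕ) : Cochain K V n →ₗ[ℝ] Cochain Γ V n where
  toFun f := ⟨fun g => f.1 (φ ∘ g), by
    obtain ⟨C, hC⟩ := f.2
    exact ⟨C, fun g => hC _⟩⟩
  map_add' _ _ := rfl
  map_smul' _ _ := rfl

theorem delta_cochainMap (φ : Γ →* K) (ρ : NormedAction K V) (n : ℕ) (f : Cochain K V n) :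
    delta (restrict φ ρ) n (cochainMap φ n f) = cochainMap φ (n + 1) (delta ρ n f) := by
  ext g
  change ρ (φ (g 0)) (f.1 _) + _ = ρ (φ (g 0)) (f.1 _) + _
  congr 1
  refine Finset.sum_congr rfl fun j _ => ?_
  change _ • f.1 (φ ∘ _) = _
  rw [Fin.comp_contractNth (· * ·) (· * ·) (map_mul φ)]

theorem cochainMap_mem_cocycles (φ : Γ →* K) (ρ : NormedAction K V) (n : ℕ)
    (f : Cochain K V n) (hf : f ∈ cocycles ρ n) :
    cochainMap φ n f ∈ cocycles (restrict φ ρ) n := by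
  have hf' : delta ρ n f = 0 := hf
  change delta (restrict φ ρ) n (cochainMap φ n f) = 0
  rw [delta_cochainMap, hf', map_zero]

theorem cochainMap_mem_coboundaries (φ : Γ →* K) (ρ : NormedAction K V) (n : ℕ)
    (f : Cochain K V n) (hf : f ∈ coboundaries ρ n) :
    cochainMap φ n f ∈ coboundaries (restrict φ ρ) n := by
  cases n with
  | zero =>
    have hf' : f = 0 := hf
    rw [hf', map_zero]
    exact Submodule.zero_mem _
  | succ n =>
    obtain ⟨f', rfl⟩ := hf
    exact ⟨cochainMap φ n f', delta_cochainMap φ ρ n f'⟩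

/-- The induced restriction map `H^n_b(φ; V) : H^n_b(K; V) → H^n_b(Γ; φ⁻¹V)`. -/
def cohomologyMap (φ : Γ →* K) (ρ : NormedAction K V) (n : ℕ) :
    Cohomology ρ n →ₗ[ℝ] Cohomology (restrict φ ρ) n :=
  Submodule.mapQ _ _
    ((cochainMap φ n).restrict (cochainMap_mem_cocycles φ ρ n))
    (fun f hf => cochainMap_mem_coboundaries φ ρ n f.1 hf)

end Restriction

/-- A group `G` is boundedly `n`-acyclic if `H^i_b(G; ℝ) = 0` for `1 ≤ i ≤ n`, where `ℝ` carries
the trivial action. -/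
def IsBoundedlyAcyclic (G : Type u) [Group G] (n : ℕ∞) : Prop :=
  ∀ i : ℕ, 1 ≤ i → (i : ℕ∞) ≤ n → Subsingleton (Cohomology (1 : NormedAction G ℝ) i)

end

end BoundedCohomology

/-! Write H for the kernel of φ and I = ℓ^∞(K, W'), the dual of ℓ¹(K, W). Finitely supported
functions suffice for ℓ¹, since completing does not change the dual. The module I is relatively
injective, and its higher bounded cohomology over K vanishes. By Shapiro's argument, evaluation at 1
turns equivariant I-valued cochains on Γ into H-invariant W'-valued functions. When φ is surjective,
a section of φ gives an H-equivariant retraction of Γ onto H, so in positive degrees H^i_b(Γ; I)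
vanishes exactly when H^i_b(H; W') does.

(4) ⇒ (1). Acyclicity with real coefficients passes to trivial dual coefficients, because real
primitives can be chosen linearly and boundedly (`IsBoundedlyAcyclic.exists_contraction`, by the
open mapping theorem and the injectivity of ℓ^∞). Hence H^i_b(Γ; I) = 0 for 1 ≤ i ≤ n
(`IsBoundedlyAcyclic.exists_delta_eq_translation`). The sequence 0 → W' → I → Q → 0, with Q the dual
of the kernel of ℓ¹(K, W) → W, is exact on bounded cochains by Hahn–Banach. As Q is again a dual
module, the four lemma gives an induction on the degree (`RestrictionSurjective.succ`,
`RestrictionInjective.succ`) starting from invariants in degree 0.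

(2) ⇒ (3). In degree 0, the indicator function of φ(Γ) forces φ to be surjective. A relatively
injective W' is an equivariant retract of I, so its cohomology over K vanishes, and surjectivity of
restriction carries the vanishing to Γ.

(3) ⇒ (4). Apply (3) to I with W one-dimensional and descend to H (`exists_delta_eq_ker`). -/

namespace BoundedCohomology

noncomputable section

/-! ### Homogeneous cochains and the prism homotopy -/

section Homogeneous

variable {X : Type u} {Y : Type v} {V : Type w} [NormedAddCommGroup V]

/-- The prism operator of a map `q : X → X`, a homotopy between the identity and
precomposition with `q`. -/
def prism (q : X → X) : (m : ℕ) → ((Fin (m + 1) → X) → V) → (Fin m → X) → V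
  | 0, _, _ => 0
  | m + 1, Φ, a => Φ (Fin.cons (q (a 0)) a : Fin (m + 2) → X) -
      prism q m (fun a' => Φ (Fin.cons (q (a 0)) a' : Fin (m + 2) → X)) (Fin.tail a)

theorem prism_sub (q : X → X) (m : ℕ) (Φ Ψ : (Fin (m + 1) → X) → V) :
    prism q m (fun a => Φ a - Ψ a) = fun a => prism q m Φ a - prism q m Ψ a := by
  induction m with
  | zero => funext a; simp [prism]
  | succ m ih =>
    funext a
    simp only [prism, ih]
    abel

/-- Ensures that the prism of an H-invariant cochain is H-invariant when `q` commutes with left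
multiplication by H. -/
theorem prism_comp {q t : X → X} (hqt : ∀ x, q (t x) = t (q x)) (m : ℕ)
    (Φ : (Fin (m + 1) → X) → V) (a : Fin m → X) :
    prism q m Φ (t ∘ a) = prism q m (fun a' => Φ (t ∘ a')) a := by
  induction m with
  | zero => rfl
  | succ m ih =>
    have e : ∀ {k : ℕ} (b : X) (x : Fin k → X),
        (Fin.cons (t b) (t ∘ x) : Fin (k + 1) → X) = t ∘ (Fin.cons b x : Fin (k + 1) → X) := by
      intro k b x
      funext i
      refine Fin.cases ?_ (fun i => ?_) i <;> simp
    have e' : Fin.tail (t ∘ a) = t ∘ Fin.tail a := rfl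
    simp only [prism, Function.comp_apply, hqt, e, e', ih]

/-- Unwinding the recursion, the prism is an alternating sum of m values of Φ. -/
theorem norm_prism_le (q : X → X) (m : ℕ) {Φ : (Fin (m + 1) → X) → V} {C : ℝ}
    (hΦ : ∀ a, ‖Φ a‖ ≤ C) (a : Fin m → X) : ‖prism q m Φ a‖ ≤ m * C := by
  induction m with
  | zero => simp [prism]
  | succ m ih =>
    refine (norm_sub_le _ _).trans ((add_le_add (hΦ _) (ih (fun a' => hΦ _) _)).trans_eq ?_)
    push_cast
    ring

variable [NormedSpace ℝ V]

/-- The homogeneous coboundary `(d Φ)(a_0, …, a_m) = ∑ j, (-1)^j Φ(a_0, …, â_j, …, a_m)`. -/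
def homogeneousDelta {m : ℕ} (Φ : (Fin m → X) → V) (a : Fin (m + 1) → X) : V :=
  ∑ j : Fin (m + 1), (-1 : ℝ) ^ (j : ℕ) • Φ (a ∘ j.succAbove)

/-- Splits off the face omitting the apex of a cone. Coning with apex 1 makes a cocycle a
coboundary, and the prism recursion is an iterated cone. -/
theorem homogeneousDelta_cons {m : ℕ} (Φ : (Fin (m + 1) → X) → V) (b : X) (a : Fin (m + 1) → X) :
    homogeneousDelta Φ (Fin.cons b a : Fin (m + 2) → X) =
      Φ a - homogeneousDelta (fun a' : Fin m → X => Φ (Fin.cons b a' : Fin (m + 1) → X)) a := by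
  unfold homogeneousDelta
  rw [Fin.sum_univ_succ, sub_eq_add_neg, ← Finset.sum_neg_distrib]
  refine congrArg₂ (· + ·) ?_ (Finset.sum_congr rfl fun j _ => ?_)
  · simp only [Fin.val_zero, pow_zero, one_smul]
    rfl
  · rw [Fin.val_succ, pow_succ, mul_neg_one, neg_smul]
    congr 3
    funext i
    refine Fin.cases ?_ (fun i => ?_) i
    · simp
    · simp

theorem homogeneousDelta_sub {m : ℕ} (Φ Ψ : (Fin m → X) → V) :
    homogeneousDelta (Φ - Ψ) = homogeneousDelta Φ - homogeneousDelta Ψ := by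
  funext a
  simp [homogeneousDelta, smul_sub, Finset.sum_sub_distrib]

theorem homogeneousDelta_add {m : ℕ} (Φ Ψ : (Fin m → X) → V) :
    homogeneousDelta (Φ + Ψ) = homogeneousDelta Φ + homogeneousDelta Ψ := by
  funext a
  simp [homogeneousDelta, smul_add, Finset.sum_add_distrib]

theorem map_homogeneousDelta {V' : Type*} [NormedAddCommGroup V'] [NormedSpace ℝ V']
    (T : V →ₗ[ℝ] V') {m : ℕ} (Φ : (Fin m → X) → V) (a : Fin (m + 1) → X) :
    T (homogeneousDelta Φ a) = homogeneousDelta (fun a' => T (Φ a')) a := by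
  simp [homogeneousDelta, map_sum]

/-- Induction on the degree: freezing the first vertex at `q b` leaves a prism identity one degree
lower, and the cone formula accounts for the remaining faces. -/
theorem homogeneousDelta_prism_add (q : X → X) (m : ℕ) (Φ : (Fin (m + 1) → X) → V)
    (a : Fin (m + 1) → X) :
    homogeneousDelta (prism q m Φ) a + prism q (m + 1) (homogeneousDelta Φ) a =
      Φ a - Φ (q ∘ a) := by
  induction m with
  | zero =>
    have h0 : ∀ (b : X) (x : Fin 1 → X), homogeneousDelta
        (fun a' : Fin 0 → X => Φ (Fin.cons b a' : Fin 1 → X)) x = Φ (fun _ => b) := by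
      intro b x
      unfold homogeneousDelta
      rw [Fin.sum_univ_succ, Fin.val_zero, pow_zero, one_smul, Finset.univ_eq_empty,
        Finset.sum_empty, add_zero]
      exact congrArg Φ (funext fun i => Fin.cases rfl (fun i => i.elim0) i)
    have h1 : homogeneousDelta (prism q 0 Φ) a = 0 := by simp [homogeneousDelta, prism]
    rw [h1, zero_add]
    simp only [prism, sub_zero]
    rw [homogeneousDelta_cons, h0]
    congr 2
    funext i
    exact Fin.cases rfl (fun i => i.elim0) i
  | succ m ih =>
    obtain ⟨b, x, rfl⟩ : ∃ b x, a = Fin.cons b x := ⟨a 0, Fin.tail a, (Fin.cons_self_tail a).symm⟩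
    have e1 : (fun a' : Fin m → X => prism q (m + 1) Φ (Fin.cons b a' : Fin (m + 1) → X)) =
        (fun a' => Φ (Fin.cons (q b) (Fin.cons b a' : Fin (m + 1) → X) : Fin (m + 2) → X)) -
        prism q m (fun a' => Φ (Fin.cons (q b) a' : Fin (m + 2) → X)) := by
      funext a'
      simp [prism]
    have e2 : (fun a' : Fin (m + 2) → X => homogeneousDelta Φ (Fin.cons (q b) a' : Fin (m + 3) → X))
        = fun a' => Φ a' -
          homogeneousDelta (fun a'' => Φ (Fin.cons (q b) a'' : Fin (m + 2) → X)) a' := by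
      funext a'
      exact homogeneousDelta_cons _ _ _
    rw [homogeneousDelta_cons, e1, homogeneousDelta_sub]
    conv_lhs => enter [2]; unfold prism
    simp only [Fin.cons_zero, Fin.tail_cons]
    rw [e2, prism_sub, homogeneousDelta_cons, homogeneousDelta_cons]
    have h := ih (fun a' => Φ (Fin.cons (q b) a' : Fin (m + 2) → X)) x
    have e3 : q ∘ (Fin.cons b x : Fin (m + 2) → X) = Fin.cons (q b) (q ∘ x) := by
      funext i
      refine Fin.cases ?_ (fun i => ?_) i <;> simp
    rw [e3]
    simp only [Pi.sub_apply]
    rw [eq_sub_of_add_eq h]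
    abel

end Homogeneous

/-! ### Homogeneous versus inhomogeneous cochains -/

section Comparison

variable {G : Type u} [Group G] {V : Type w} [NormedAddCommGroup V] [NormedSpace ℝ V]

/-- A homogeneous cochain is equivariant for the diagonal action. -/
def IsHomogeneous (ρ : NormedAction G V) {m : ℕ} (Φ : (Fin m → G) → V) : Prop :=
  ∀ (g : G) (a : Fin m → G), Φ (g • a) = ρ g (Φ a)

theorem IsHomogeneous.homogeneousDelta {ρ : NormedAction G V} {m : ℕ} {Φ : (Fin m → G) → V}
    (hΦ : IsHomogeneous ρ Φ) : IsHomogeneous ρ (homogeneousDelta Φ) := by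
  intro g a
  have h := map_homogeneousDelta (ρ g).toLinearEquiv.toLinearMap Φ a
  refine Eq.trans ?_ h.symm
  exact Finset.sum_congr rfl fun j _ => congrArg _ (hΦ g _)

/-- The homogeneous cochain attached to an inhomogeneous one. -/
def Cochain.toHomogeneous (ρ : NormedAction G V) {n : ℕ} (f : Cochain G V n)
    (a : Fin (n + 1) → G) : V :=
  ρ (a 0) (f fun i => (a i.castSucc)⁻¹ * a i.succ)

theorem Cochain.isHomogeneous_toHomogeneous (ρ : NormedAction G V) {n : ℕ} (f : Cochain G V n) :
    IsHomogeneous ρ (f.toHomogeneous ρ) := by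
  intro g a
  simp [Cochain.toHomogeneous, mul_assoc]

theorem Cochain.exists_norm_toHomogeneous_le (ρ : NormedAction G V) {n : ℕ} (f : Cochain G V n) :
    ∃ C, ∀ a, ‖f.toHomogeneous ρ a‖ ≤ C := by
  obtain ⟨C, hC⟩ := f.2
  exact ⟨C, fun a => by simpa [Cochain.toHomogeneous] using hC _⟩

/-- The inhomogeneous cochain attached to a bounded homogeneous one. -/
def ofHomogeneous {n : ℕ} (Φ : (Fin (n + 1) → G) → V) (hΦ : ∃ C, ∀ a, ‖Φ a‖ ≤ C) :
    Cochain G V n :=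
  ⟨fun g => Φ (Fin.partialProd g), hΦ.imp fun _ hC _ => hC _⟩

theorem ofHomogeneous_apply {n : ℕ} (Φ : (Fin (n + 1) → G) → V) (hΦ : ∃ C, ∀ a, ‖Φ a‖ ≤ C)
    (g : Fin n → G) : ofHomogeneous Φ hΦ g = Φ (Fin.partialProd g) := rfl

theorem toHomogeneous_partialProd (ρ : NormedAction G V) {n : ℕ} (f : Cochain G V n)
    (g : Fin n → G) : f.toHomogeneous ρ (Fin.partialProd g) = f g := by
  simp [Cochain.toHomogeneous, Fin.partialProd_right_inv]

/-- Every tuple is a translate of one of the form (1, g₁, g₁g₂, …), so equivariance reduces equality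
to these. -/
theorem IsHomogeneous.ext {ρ : NormedAction G V} {n : ℕ} {Φ Ψ : (Fin (n + 1) → G) → V}
    (hΦ : IsHomogeneous ρ Φ) (hΨ : IsHomogeneous ρ Ψ)
    (h : ∀ g : Fin n → G, Φ (Fin.partialProd g) = Ψ (Fin.partialProd g)) : Φ = Ψ := by
  funext a
  rw [← Fin.partialProd_left_inv a, hΦ, hΨ, h]

theorem IsHomogeneous.homogeneousDelta_partialProd {ρ : NormedAction G V} {n : ℕ}
    {Φ : (Fin (n + 1) → G) → V} (hΦ : IsHomogeneous ρ Φ) (g : Fin (n + 1) → G) :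
    BoundedCohomology.homogeneousDelta Φ (Fin.partialProd g) =
      ρ (g 0) (Φ (Fin.partialProd fun i => g i.succ)) +
      ∑ j : Fin (n + 1), (-1 : ℝ) ^ ((j : ℕ) + 1) •
        Φ (Fin.partialProd (Fin.contractNth j (· * ·) g)) := by
  unfold BoundedCohomology.homogeneousDelta
  rw [Fin.sum_univ_succ]
  refine congrArg₂ (· + ·) ?_ (Finset.sum_congr rfl fun j _ => ?_)
  · rw [Fin.val_zero, pow_zero, one_smul, ← hΦ]
    congr 1
    funext i
    simp only [Function.comp_apply, Fin.zero_succAbove, Pi.smul_apply, smul_eq_mul]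
    exact Fin.partialProd_succ' g i
  · rw [Fin.partialProd_contractNth, Fin.val_succ]

theorem delta_ofHomogeneous {ρ : NormedAction G V} {n : ℕ} {Φ : (Fin (n + 1) → G) → V}
    (hΦ : IsHomogeneous ρ Φ) (hb : ∃ C, ∀ a, ‖Φ a‖ ≤ C) (g : Fin (n + 1) → G) :
    delta ρ n (ofHomogeneous Φ hb) g = homogeneousDelta Φ (Fin.partialProd g) := by
  rw [hΦ.homogeneousDelta_partialProd, delta_apply]
  rfl

theorem homogeneousDelta_toHomogeneous (ρ : NormedAction G V) {n : ℕ} (f : Cochain G V n) :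
    homogeneousDelta (f.toHomogeneous ρ) = (delta ρ n f).toHomogeneous ρ := by
  refine (f.isHomogeneous_toHomogeneous ρ).homogeneousDelta.ext
    ((delta ρ n f).isHomogeneous_toHomogeneous ρ) fun g => ?_
  rw [(f.isHomogeneous_toHomogeneous ρ).homogeneousDelta_partialProd]
  simp only [toHomogeneous_partialProd]
  exact (delta_apply ρ n f g).symm

/-- A bounded cochain whose homogeneous version is the coboundary of a bounded homogeneous cochain
is a coboundary. -/
theorem exists_delta_eq_of_homogeneous {ρ : NormedAction G V} {n : ℕ} (f : Cochain G V (n + 1))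
    {Ψ : (Fin (n + 1) → G) → V} (hΨ : IsHomogeneous ρ Ψ) (hb : ∃ C, ∀ a, ‖Ψ a‖ ≤ C)
    (h : homogeneousDelta Ψ = f.toHomogeneous ρ) : ∃ b, delta ρ n b = f := by
  refine ⟨ofHomogeneous Ψ hb, Cochain.ext fun g => ?_⟩
  rw [delta_ofHomogeneous hΨ, h, toHomogeneous_partialProd]

theorem toHomogeneous_zero (ρ : NormedAction G V) (n : ℕ) :
    (0 : Cochain G V n).toHomogeneous ρ = 0 := by
  funext a
  exact map_zero (ρ (a 0))

/-- In positive degrees, cohomology vanishes if and only if cocycles are coboundaries. -/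
theorem subsingleton_cohomology_succ_iff (ρ : NormedAction G V) (n : ℕ) :
    Subsingleton (Cohomology ρ (n + 1)) ↔
      ∀ f, delta ρ (n + 1) f = 0 → ∃ b, delta ρ n b = f := by
  rw [Submodule.Quotient.subsingleton_iff, Submodule.submoduleOf_eq_top]
  rfl

end Comparison

/-! ### The module ℓ¹(K, W) and its dual ℓ^∞(K, W') -/

/-- The finitely supported functions `K → W`, with the `ℓ¹`-norm. -/
def FinL1 (K : Type v) (W : Type w) [NormedAddCommGroup W] [NormedSpace ℝ W] : Type (max v w) :=
  K →₀ W

namespace FinL1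

theorem sum_norm_add_le {K : Type v} {W : Type w} [NormedAddCommGroup W]
    (ξ η : K →₀ W) :
    ((ξ + η).sum fun _ w => ‖w‖) ≤ (ξ.sum fun _ w => ‖w‖) + η.sum fun _ w => ‖w‖ := by
  classical
  have key : ∀ ζ : K →₀ W, ζ.support ⊆ ξ.support ∪ η.support →
      (ζ.sum fun _ w => ‖w‖) = ∑ x ∈ ξ.support ∪ η.support, ‖ζ x‖ :=
    fun ζ hζ => Finsupp.sum_of_support_subset ζ hζ _ fun _ _ => norm_zero
  rw [key _ Finsupp.support_add, key ξ Finset.subset_union_left, key η Finset.subset_union_right,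
    ← Finset.sum_add_distrib]
  exact Finset.sum_le_sum fun x _ => norm_add_le _ _

theorem sum_norm_eq_zero_iff {K : Type v} {W : Type w} [NormedAddCommGroup W]
    (ξ : K →₀ W) : (ξ.sum fun _ w => ‖w‖) = 0 ↔ ξ = 0 := by
  rw [Finsupp.sum, Finset.sum_eq_zero_iff_of_nonneg fun _ _ => norm_nonneg _]
  constructor
  · intro h
    ext x
    by_contra hx
    exact hx (norm_eq_zero.1 (h x (Finsupp.mem_support_iff.2 hx)))
  · rintro rfl x _
    exact norm_zero

section Basic

variable {K : Type v} {W : Type w} [NormedAddCommGroup W] [NormedSpace ℝ W]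

instance : AddCommGroup (FinL1 K W) := inferInstanceAs (AddCommGroup (K →₀ W))

instance : Module ℝ (FinL1 K W) := inferInstanceAs (Module ℝ (K →₀ W))

instance : Norm (FinL1 K W) := ⟨fun ξ => Finsupp.sum (M := W) ξ fun _ w => ‖w‖⟩

theorem sum_norm_smul (c : ℝ) (ξ : K →₀ W) :
    ((c • ξ).sum fun _ w => ‖w‖) = ‖c‖ * ξ.sum fun _ w => ‖w‖ := by
  rw [Finsupp.sum_of_support_subset _ Finsupp.support_smul _ fun _ _ => norm_zero,
    Finsupp.sum, Finset.mul_sum]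
  exact Finset.sum_congr rfl fun x _ => norm_smul c (ξ x)

theorem normedSpaceCore : NormedSpace.Core ℝ (FinL1 K W) where
  norm_nonneg _ := Finset.sum_nonneg fun _ _ => norm_nonneg _
  norm_smul := sum_norm_smul
  norm_triangle := sum_norm_add_le
  norm_eq_zero_iff := sum_norm_eq_zero_iff

instance : NormedAddCommGroup (FinL1 K W) := .ofCore normedSpaceCore

instance : NormedSpace ℝ (FinL1 K W) := .ofCore normedSpaceCore

/-- The function supported at one point. -/
def single (x : K) : W →ₗ[ℝ] FinL1 K W := Finsupp.lsingle x

theorem norm_single (x : K) (w : W) : ‖single x w‖ = ‖w‖ :=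
  Finsupp.sum_single_index (M := W) norm_zero

theorem ext_single {E : Type*} [AddCommGroup E] [Module ℝ E] {S T : FinL1 K W →ₗ[ℝ] E}
    (h : ∀ x w, S (single x w) = T (single x w)) : S = T :=
  Finsupp.lhom_ext h

theorem clm_ext_single {E : Type*} [NormedAddCommGroup E] [NormedSpace ℝ E]
    {S T : FinL1 K W →L[ℝ] E} (h : ∀ x w, S (single x w) = T (single x w)) : S = T :=
  ContinuousLinearMap.coe_injective (ext_single h)

/-- The bounded linear map determined by a uniformly bounded family. -/
def lift {E : Type*} [NormedAddCommGroup E] [NormedSpace ℝ E] (T : K → W →L[ℝ] E) {C : ℝ}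
    (hT : ∀ x, ‖T x‖ ≤ C) : FinL1 K W →L[ℝ] E :=
  LinearMap.mkContinuous (Finsupp.lsum ℕ (fun x => (T x : W →ₗ[ℝ] E)) : (K →₀ W) →ₗ[ℝ] E) C
    fun ξ => by
      refine (norm_sum_le _ _).trans ?_
      refine le_of_le_of_eq ?_ (Finset.mul_sum _ _ _).symm
      exact Finset.sum_le_sum fun x _ => (T x).le_of_opNorm_le (hT x) _

theorem lift_single {E : Type*} [NormedAddCommGroup E] [NormedSpace ℝ E] (T : K → W →L[ℝ] E)
    {C : ℝ} (hT : ∀ x, ‖T x‖ ≤ C) (x : K) (w : W) : lift T hT (single x w) = T x w :=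
  Finsupp.sum_single_index (M := W) (map_zero (T x))

theorem norm_lift_le {E : Type*} [NormedAddCommGroup E] [NormedSpace ℝ E] (T : K → W →L[ℝ] E)
    {C : ℝ} (hC : 0 ≤ C) (hT : ∀ x, ‖T x‖ ≤ C) : ‖lift T hT‖ ≤ C :=
  LinearMap.mkContinuous_norm_le _ hC _

/-- Evaluation at a point of an element of `ℓ^∞(K, W') = ℓ¹(K, W)'`. -/
def eval (x : K) : StrongDual ℝ (FinL1 K W) →ₗ[ℝ] StrongDual ℝ W where
  toFun F := LinearMap.mkContinuous (F.toLinearMap.comp (single x)) ‖F‖ fun w =>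
    (F.le_opNorm (single x w)).trans_eq (by rw [norm_single])
  map_add' _ _ := rfl
  map_smul' _ _ := rfl

@[simp]
theorem eval_apply (x : K) (F : StrongDual ℝ (FinL1 K W)) (w : W) :
    eval x F w = F (single x w) := rfl

theorem norm_eval_le (x : K) (F : StrongDual ℝ (FinL1 K W)) : ‖eval x F‖ ≤ ‖F‖ :=
  ContinuousLinearMap.opNorm_le_bound _ (norm_nonneg F) fun w =>
    (F.le_opNorm (single x w)).trans_eq (by rw [norm_single])

theorem ext_eval {F F' : StrongDual ℝ (FinL1 K W)} (h : ∀ x, eval x F = eval x F') : F = F' :=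
  clm_ext_single fun x w => congrArg (fun f => f w) (h x)

/-- With `ext_eval`, `norm_eval_le` and `norm_lift_le`, this identifies the dual of ℓ¹(K, W) with
the bounded families K → W'. -/
theorem eval_lift (T : K → StrongDual ℝ W) {C : ℝ} (hT : ∀ x, ‖T x‖ ≤ C) (x : K) :
    eval x (lift T hT) = T x := by
  ext w
  exact lift_single T hT x w

end Basic

section Action

variable {K : Type v} [Group K] {W : Type w} [NormedAddCommGroup W] [NormedSpace ℝ W]

variable (K W) in
/-- The action of `K` on `ℓ¹(K, W)` whose dual is the action `(k • F) x = F (x * k)` on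
`ℓ^∞(K, W')`. -/
def translation : NormedAction K (FinL1 K W) where
  toFun k :=
    { (Finsupp.domLCongr (Equiv.mulRight k⁻¹) : (K →₀ W) ≃ₗ[ℝ] (K →₀ W)) with
      norm_map' := fun ξ => Finsupp.sum_equivMapDomain (M := W) _ ξ _ }
  map_one' := LinearIsometryEquiv.toLinearEquiv_injective <| LinearEquiv.toLinearMap_injective <|
    ext_single fun x w =>
      (Finsupp.equivMapDomain_single _ _ _).trans
        (congrArg (fun y => Finsupp.single y w) (show x * 1⁻¹ = x by simp))
  map_mul' k l := LinearIsometryEquiv.toLinearEquiv_injective <|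
    LinearEquiv.toLinearMap_injective <| ext_single fun x w => by
      refine (Finsupp.equivMapDomain_single _ _ _).trans (Eq.symm ?_)
      refine (congrArg (Finsupp.equivMapDomain _) (Finsupp.equivMapDomain_single _ _ _)).trans ?_
      refine (Finsupp.equivMapDomain_single _ _ _).trans ?_
      exact congrArg (fun y => Finsupp.single y w)
        (show x * l⁻¹ * k⁻¹ = x * (k * l)⁻¹ by rw [mul_inv_rev, mul_assoc])

@[simp]
theorem translation_single (k x : K) (w : W) :
    translation K W k (single x w) = single (x * k⁻¹) w :=
  Finsupp.equivMapDomain_single _ _ _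

@[simp]
theorem eval_dualAction (k x : K) (F : StrongDual ℝ (FinL1 K W)) :
    eval x (dualAction (translation K W) k F) = eval (x * k) F := by
  ext w
  rw [eval_apply, dualAction_apply, translation_single, inv_inv, eval_apply]

/-- The equivariant map `ℓ¹(K, W) → W`, `single x w ↦ x⁻¹ • w`. -/
def action (ρ : NormedAction K W) : FinL1 K W →L[ℝ] W :=
  lift (C := 1) (fun x => (ρ x⁻¹ : W →L[ℝ] W)) fun _ =>
    ContinuousLinearMap.opNorm_le_bound _ zero_le_one fun _ =>
      ((LinearIsometryEquiv.norm_map _ _).trans (one_mul _).symm).le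

@[simp]
theorem action_single (ρ : NormedAction K W) (x : K) (w : W) :
    action ρ (single x w) = ρ x⁻¹ w := lift_single _ _ _ _

theorem isEquivariant_action (ρ : NormedAction K W) :
    IsEquivariant (translation K W) ρ (action ρ) := fun k ξ => by
  have h : (action ρ).toLinearMap.comp (translation K W k).toLinearEquiv.toLinearMap =
      (ρ k).toLinearEquiv.toLinearMap.comp (action ρ).toLinearMap :=
    ext_single fun x w => by
      change action ρ (translation K W k (single x w)) = ρ k (action ρ (single x w))
      simp
  exact LinearMap.congr_fun h ξ

/-- The module `ℓ^∞(K, W')` is relatively injective. -/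
theorem isRelativelyInjective_dualAction_translation :
    IsRelativelyInjective (dualAction (translation K W)) := by
  intro A B _ _ _ _ ρA ρB ι σ α hι hσ hσι hα
  -- The extension takes at x the value of x⁻¹ασx, the conjugate of α ∘ σ by x. Evaluated at x, this
  -- is α(σ(x b)) at 1.
  have hb : ∀ (b : B) (x : K), ‖eval x (dualAction (translation K W) x⁻¹ (α (σ (ρB x b))))‖ ≤
      ‖α‖ * ‖b‖ := fun b x => by
    refine (norm_eval_le _ _).trans ?_
    rw [LinearIsometryEquiv.norm_map]
    refine (α.le_opNorm _).trans (mul_le_mul_of_nonneg_left ?_ (norm_nonneg _))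
    refine (σ.le_of_opNorm_le hσ _).trans ?_
    rw [one_mul, LinearIsometryEquiv.norm_map]
  let β : B →L[ℝ] StrongDual ℝ (FinL1 K W) := LinearMap.mkContinuous
    { toFun := fun b => lift _ (hb b)
      map_add' := fun b b' => ext_eval fun x => by simp only [map_add, eval_lift]
      map_smul' := fun c b => ext_eval fun x => by
        simp only [map_smul, eval_lift, RingHom.id_apply] } ‖α‖
    fun b => norm_lift_le _ (by positivity) (hb b)
  have hβ : ∀ b x, eval x (β b) = eval 1 (α (σ (ρB x b))) := fun b x => by
    refine (eval_lift _ (hb b) x).trans ?_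
    rw [eval_dualAction, mul_inv_cancel]
  refine ⟨β, fun k b => ext_eval fun x => ?_, ContinuousLinearMap.ext fun a => ext_eval fun x => ?_,
    LinearMap.mkContinuous_norm_le _ (norm_nonneg α) _⟩
  · rw [hβ, eval_dualAction, hβ, map_mul]
    rfl
  · have h : σ (ι (ρA x a)) = ρA x a := congrArg (fun T => T (ρA x a)) hσι
    rw [ContinuousLinearMap.comp_apply, hβ, ← hι, h, hα, eval_dualAction, one_mul]

end Action

end FinL1

/-! ### Extension into ℓ^∞ and bounded right inverses -/

section BanachSpaces

open scoped ENNReal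

/-- Bounded linear maps into `ℓ^∞(S)` extend from subspaces. -/
theorem exists_extension_lp_infty {S : Type*} {E : Type*} [NormedAddCommGroup E] [NormedSpace ℝ E]
    (p : Submodule ℝ E) (k : p →L[ℝ] lp (fun _ : S => ℝ) ∞) :
    ∃ K : E →L[ℝ] lp (fun _ : S => ℝ) ∞, ∀ z : p, K z = k z := by
  have hk : ∀ s (z : p), ‖k z s‖ ≤ ‖k‖ * ‖z‖ := fun s z =>
    (lp.norm_apply_le_norm ENNReal.top_ne_zero (k z) s).trans (k.le_opNorm z)
  let coord : S → StrongDual ℝ p := fun s => LinearMap.mkContinuous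
    { toFun := fun z => k z s
      map_add' := fun z z' => by rw [map_add]; rfl
      map_smul' := fun c z => by rw [map_smul]; rfl } ‖k‖ (hk s)
  -- Hahn–Banach in each coordinate; preserving norms keeps the extensions uniformly bounded.
  choose g hg hgn using fun s => exists_extension_norm_eq p (coord s)
  have hb : ∀ x s, ‖g s x‖ ≤ ‖k‖ * ‖x‖ := fun x s =>
    (g s).le_of_opNorm_le ((hgn s).trans_le (LinearMap.mkContinuous_norm_le _ (norm_nonneg k) _)) x
  have hmem : ∀ x, Memℓp (fun s => g s x) ∞ := fun x => memℓp_infty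
    ⟨‖k‖ * ‖x‖, by rintro _ ⟨s, rfl⟩; exact hb x s⟩
  refine ⟨LinearMap.mkContinuous
    { toFun := fun x => ⟨fun s => g s x, hmem x⟩
      map_add' := fun x y => Subtype.ext (funext fun s => map_add (g s) x y)
      map_smul' := fun c x => Subtype.ext (funext fun s => map_smul (g s) c x) } ‖k‖
    fun x => lp.norm_le_of_forall_le (by positivity) (hb x), fun z => ?_⟩
  exact Subtype.ext (funext fun s => hg s z)

/-- If the kernel of `D : E → F` is complemented and `D` has closed range `Z`, then `D` has a
bounded linear right inverse on `Z`. -/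
theorem exists_rightInverse_of_projection {E F : Type*} [NormedAddCommGroup E] [NormedSpace ℝ E]
    [CompleteSpace E] [NormedAddCommGroup F] [NormedSpace ℝ F] [CompleteSpace F]
    (D : E →L[ℝ] F) (p : E →L[ℝ] E) (hDp : ∀ x, D (p x) = 0) (hp : ∀ x, D x = 0 → p x = x)
    (Z : Submodule ℝ F) (hZ : IsClosed (Z : Set F)) (hDZ : ∀ x, D x ∈ Z)
    (hZD : ∀ z ∈ Z, ∃ x, D x = z) : ∃ k : Z →L[ℝ] E, ∀ z : Z, D (k z) = z := by
  have : CompleteSpace Z := hZ.completeSpace_coe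
  have : CompleteSpace p.ker := p.isClosed_ker.completeSpace_coe
  -- The kernel of p is a closed complement of the kernel of D, so D maps it bijectively onto Z and
  -- the open mapping theorem applies.
  let D' : p.ker →L[ℝ] Z := (D.comp p.ker.subtypeL).codRestrict Z fun x => hDZ x
  have hinj : D'.ker = ⊥ := by
    refine LinearMap.ker_eq_bot'.2 fun x hx => Subtype.ext ?_
    have h : D x = 0 := congrArg Subtype.val hx
    exact (hp _ h).symm.trans x.2
  have hsurj : D'.range = ⊤ := by
    refine LinearMap.range_eq_top.2 fun z => ?_
    obtain ⟨x, hx⟩ := hZD z z.2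
    refine ⟨⟨x - p x, ?_⟩, Subtype.ext ?_⟩
    · change p (x - p x) = 0
      rw [map_sub, hp (p x) (hDp x), sub_self]
    · change D (x - p x) = z
      rw [map_sub, hDp, sub_zero, hx]
  let e := ContinuousLinearEquiv.ofBijective D' hinj hsurj
  refine ⟨p.ker.subtypeL.comp (e.symm : Z →L[ℝ] p.ker), fun z => ?_⟩
  exact congrArg Subtype.val (e.apply_symm_apply z)

end BanachSpaces

/-! ### Bounded linear primitives and trivial dual coefficients -/

section Contraction

open scoped ENNReal

/-- Postcomposition of cochains with a bounded linear map. -/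
def Cochain.postcomp {S V V' : Type*} [NormedAddCommGroup V] [NormedSpace ℝ V]
    [NormedAddCommGroup V'] [NormedSpace ℝ V'] (T : V →L[ℝ] V') {n : ℕ} (f : Cochain S V n) :
    Cochain S V' n :=
  ⟨fun x => T (f x), f.2.elim fun C hC => ⟨‖T‖ * C, fun x => T.le_opNorm_of_le (hC x)⟩⟩

theorem Cochain.postcomp_apply {S V V' : Type*} [NormedAddCommGroup V] [NormedSpace ℝ V]
    [NormedAddCommGroup V'] [NormedSpace ℝ V'] (T : V →L[ℝ] V') {n : ℕ} (f : Cochain S V n)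
    (x : Fin n → S) : f.postcomp T x = T (f x) := rfl

variable {G : Type u} [Group G]

/-- Real bounded cochains as elements of the Banach space `ℓ^∞(G^n)`. -/
def cochainEquivLp (G : Type u) (n : ℕ) :
    Cochain G ℝ n ≃ₗ[ℝ] lp (fun _ : Fin n → G => ℝ) ∞ where
  toFun f := ⟨f.1, memℓp_infty (f.2.imp fun _ hC => by rintro _ ⟨x, rfl⟩; exact hC x)⟩
  invFun f := ⟨f, ‖f‖, fun x => lp.norm_apply_le_norm ENNReal.top_ne_zero f x⟩
  map_add' _ _ := rfl
  map_smul' _ _ := rfl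
  left_inv _ := rfl
  right_inv _ := rfl

/-- The coboundary operator as a bounded operator of Banach spaces. -/
def deltaLp (G : Type u) [Group G] (n : ℕ) :
    lp (fun _ : Fin n → G => ℝ) ∞ →L[ℝ] lp (fun _ : Fin (n + 1) → G => ℝ) ∞ :=
  LinearMap.mkContinuous ((cochainEquivLp G (n + 1)).toLinearMap ∘ₗ
    delta (1 : NormedAction G ℝ) n ∘ₗ (cochainEquivLp G n).symm.toLinearMap) (n + 2) fun f => by
    refine lp.norm_le_of_forall_le (by positivity) fun g => ?_
    have hf : ∀ x, ‖(cochainEquivLp G n).symm f x‖ ≤ ‖f‖ :=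
      lp.norm_apply_le_norm ENNReal.top_ne_zero f
    change ‖delta (1 : NormedAction G ℝ) n ((cochainEquivLp G n).symm f) g‖ ≤ _
    rw [delta_apply]
    refine (norm_add_le _ _).trans ((add_le_add (hf _) ((norm_sum_le _ _).trans
      (Finset.sum_le_card_nsmul _ _ ‖f‖ fun j _ => ?_))).trans_eq ?_)
    · rw [norm_smul, norm_pow, norm_neg, norm_one, one_pow, one_mul]
      exact hf _
    · rw [Finset.card_univ, Fintype.card_fin, nsmul_eq_mul]
      push_cast
      ring

theorem deltaLp_cochainEquivLp (n : ℕ) (f : Cochain G ℝ n) :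
    deltaLp G n (cochainEquivLp G n f) =
      cochainEquivLp G (n + 1) (delta (1 : NormedAction G ℝ) n f) := rfl

theorem deltaLp_eq_zero_iff {n : ℕ} (f : lp (fun _ : Fin n → G => ℝ) ∞) :
    deltaLp G n f = 0 ↔ delta (1 : NormedAction G ℝ) n ((cochainEquivLp G n).symm f) = 0 :=
  (cochainEquivLp G (n + 1)).map_eq_zero_iff

theorem deltaLp_deltaLp (n : ℕ) (f : lp (fun _ : Fin n → G => ℝ) ∞) :
    deltaLp G (n + 1) (deltaLp G n f) = 0 :=
  (deltaLp_eq_zero_iff _).2 (delta_delta (1 : NormedAction G ℝ) n ((cochainEquivLp G n).symm f))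

theorem delta_zero_apply {G V : Type*} [Group G] [NormedAddCommGroup V] [NormedSpace ℝ V]
    (ρ : NormedAction G V) (f : Cochain G V 0) (g : Fin 1 → G) :
    delta ρ 0 f g = ρ (g 0) (f default) - f default := by
  rw [delta_apply, Fin.sum_univ_succ, Finset.univ_eq_empty, Finset.sum_empty, add_zero,
    show (-1 : ℝ) ^ (((0 : Fin (0 + 1)) : ℕ) + 1) = -1 by norm_num, neg_smul, one_smul,
    ← sub_eq_add_neg]
  exact congrArg₂ (fun x y => ρ (g 0) (f.1 x) - f.1 y) (Subsingleton.elim _ _) (Subsingleton.elim _ _)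

theorem delta_one_zero {V : Type w} [NormedAddCommGroup V] [NormedSpace ℝ V] (f : Cochain G V 0) :
    delta (1 : NormedAction G V) 0 f = 0 :=
  Cochain.ext fun g => (delta_zero_apply 1 f g).trans (sub_self _)

/-- One step of the construction of a bounded contraction of the cochain complex. -/
theorem exists_deltaLp_rightInverse {i : ℕ}
    (h : Subsingleton (Cohomology (1 : NormedAction G ℝ) (i + 1)))
    (p : lp (fun _ : Fin i → G => ℝ) ∞ →L[ℝ] lp (fun _ : Fin i → G => ℝ) ∞)
    (hDp : ∀ x, deltaLp G i (p x) = 0) (hp : ∀ x, deltaLp G i x = 0 → p x = x) :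
    ∃ k : lp (fun _ : Fin (i + 1) → G => ℝ) ∞ →L[ℝ] lp (fun _ : Fin i → G => ℝ) ∞,
      ∀ z, deltaLp G (i + 1) z = 0 → deltaLp G i (k z) = z := by
  obtain ⟨k, hk⟩ := exists_rightInverse_of_projection (deltaLp G i) p hDp hp
    (deltaLp G (i + 1)).ker (deltaLp G (i + 1)).isClosed_ker (deltaLp_deltaLp i) (fun z hz => by
      obtain ⟨b, hb⟩ := (subsingleton_cohomology_succ_iff _ _).1 h _
        ((deltaLp_eq_zero_iff z).1 hz)
      exact ⟨cochainEquivLp G i b, by rw [deltaLp_cochainEquivLp, hb]; rfl⟩)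
  -- The right inverse is defined only on cocycles; its target is an ℓ^∞ space, so it extends to all
  -- cochains.
  obtain ⟨K, hK⟩ := exists_extension_lp_infty _ k
  exact ⟨K, fun z hz => by rw [hK ⟨z, hz⟩, hk]⟩

/-- A bounded choice k of primitives makes δk a projection onto the cocycles of the next degree, and
this projection yields the next k. The start is the identity, as δ⁰ = 0 for the trivial action. -/
theorem IsBoundedlyAcyclic.exists_projection {n : ℕ∞} (h : IsBoundedlyAcyclic G n) (i : ℕ)
    (hi : (i : ℕ∞) ≤ n) :
    ∃ p : lp (fun _ : Fin i → G => ℝ) ∞ →L[ℝ] lp (fun _ : Fin i → G => ℝ) ∞,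
      (∀ x, deltaLp G i (p x) = 0) ∧ ∀ x, deltaLp G i x = 0 → p x = x := by
  induction i with
  | zero => exact ⟨.id ℝ _, fun x => (deltaLp_eq_zero_iff _).2 (delta_one_zero _), fun x _ => rfl⟩
  | succ i ih =>
    obtain ⟨p, hDp, hp⟩ := ih (le_trans (by exact_mod_cast i.le_succ) hi)
    obtain ⟨k, hk⟩ := exists_deltaLp_rightInverse (h (i + 1) (by lia) hi) p hDp hp
    exact ⟨(deltaLp G i).comp k, fun x => deltaLp_deltaLp i (k x), hk⟩

/-- A boundedly acyclic group admits a bounded linear choice of primitives of real cocycles. -/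
theorem IsBoundedlyAcyclic.exists_contraction {n : ℕ∞} (h : IsBoundedlyAcyclic G n) (i : ℕ)
    (hi : ((i + 1 : ℕ) : ℕ∞) ≤ n) :
    ∃ (k : Cochain G ℝ (i + 1) →ₗ[ℝ] Cochain G ℝ i) (C : ℝ), 0 ≤ C ∧
      (∀ f M, 0 ≤ M → (∀ x, ‖f x‖ ≤ M) → ∀ x, ‖k f x‖ ≤ C * M) ∧
      ∀ z, delta (1 : NormedAction G ℝ) (i + 1) z = 0 → delta 1 i (k z) = z := by
  obtain ⟨p, hDp, hp⟩ := h.exists_projection i (le_trans (by exact_mod_cast i.le_succ) hi)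
  obtain ⟨k, hk⟩ := exists_deltaLp_rightInverse (h (i + 1) (by lia) hi) p hDp hp
  refine ⟨(cochainEquivLp G i).symm.toLinearMap ∘ₗ k.toLinearMap ∘ₗ
    (cochainEquivLp G (i + 1)).toLinearMap, ‖k‖, norm_nonneg k, fun f M hM hf x => ?_,
    fun z hz => ?_⟩
  · refine (lp.norm_apply_le_norm ENNReal.top_ne_zero (k (cochainEquivLp G (i + 1) f)) x).trans ?_
    exact k.le_opNorm_of_le (lp.norm_le_of_forall_le hM hf)
  · exact (cochainEquivLp G (i + 1)).injective
      (hk (cochainEquivLp G (i + 1) z) ((deltaLp_eq_zero_iff _).2 hz))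

theorem delta_postcomp {V V' : Type*} [NormedAddCommGroup V] [NormedSpace ℝ V]
    [NormedAddCommGroup V'] [NormedSpace ℝ V'] {ρ : NormedAction G V} {ρ' : NormedAction G V'}
    {T : V →L[ℝ] V'} (hT : IsEquivariant ρ ρ' T) {n : ℕ} (f : Cochain G V n) :
    delta ρ' n (f.postcomp T) = (delta ρ n f).postcomp T := by
  ext g
  rw [Cochain.postcomp_apply, delta_apply, delta_apply, map_add, map_sum, hT]
  simp only [map_smul]
  rfl

/-- Bounded acyclicity passes from real coefficients to trivial dual coefficients. -/
theorem IsBoundedlyAcyclic.exists_delta_eq {n : ℕ∞} (h : IsBoundedlyAcyclic G n) (i : ℕ)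
    (hi : ((i + 1 : ℕ) : ℕ∞) ≤ n) {W : Type w} [NormedAddCommGroup W] [NormedSpace ℝ W]
    (z : Cochain G (StrongDual ℝ W) (i + 1)) (hz : delta 1 (i + 1) z = 0) :
    ∃ b, delta (1 : NormedAction G (StrongDual ℝ W)) i b = z := by
  obtain ⟨k, C, hC, hk, hδ⟩ := h.exists_contraction i hi
  obtain ⟨M, hM⟩ := z.2
  have hM0 : 0 ≤ M := (norm_nonneg _).trans (hM 1)
  -- Evaluating at w gives a real cocycle. Linearity of `k` makes its primitive linear in w, and the
  -- norm bound on `k` makes it continuous in w.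
  let ev : W → StrongDual ℝ W →L[ℝ] ℝ := fun w => ContinuousLinearMap.apply ℝ ℝ w
  have hev : ∀ w, IsEquivariant (1 : NormedAction G (StrongDual ℝ W)) (1 : NormedAction G ℝ)
      (ev w) := fun _ _ _ => rfl
  have hb : ∀ x w, ‖k (z.postcomp (ev w)) x‖ ≤ C * M * ‖w‖ := fun x w => by
    rw [mul_assoc]
    exact hk _ _ (by positivity) (fun y => (z y).le_of_opNorm_le (hM y) w) x
  let b : Cochain G (StrongDual ℝ W) i := ⟨fun x => LinearMap.mkContinuous
    { toFun := fun w => k (z.postcomp (ev w)) x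
      map_add' := fun w w' => by
        have e : z.postcomp (ev (w + w')) = z.postcomp (ev w) + z.postcomp (ev w') :=
          Cochain.ext fun y => map_add (z y) w w'
        rw [e, map_add, Cochain.add_apply]
      map_smul' := fun c w => by
        have e : z.postcomp (ev (c • w)) = c • z.postcomp (ev w) :=
          Cochain.ext fun y => map_smul (z y) c w
        rw [e, map_smul, Cochain.smul_apply, RingHom.id_apply] } (C * M) (hb x),
    C * M, fun x => LinearMap.mkContinuous_norm_le _ (by positivity) _⟩
  refine ⟨b, Cochain.ext fun g => ContinuousLinearMap.ext fun w => ?_⟩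
  have h1 : delta (1 : NormedAction G ℝ) i (k (z.postcomp (ev w))) = z.postcomp (ev w) :=
    hδ _ (by rw [delta_postcomp (hev w), hz]; rfl)
  have h2 : (delta 1 i b).postcomp (ev w) = z.postcomp (ev w) := by
    rw [← delta_postcomp (hev w), ← h1]
    rfl
  exact congrArg (fun f : Cochain G ℝ (i + 1) => f g) h2

end Contraction

/-! ### Coinduced cochains -/

section Coinduction

variable {Γ : Type u} {K : Type v} [Group Γ] {W : Type w} [NormedAddCommGroup W] [NormedSpace ℝ W]

/-- The `ℓ^∞(K, W')`-valued cochain attached to a `W'`-valued cochain. -/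
def coinduce (s : K → Γ) {m : ℕ} (Ψ : (Fin m → Γ) → StrongDual ℝ W) {C : ℝ}
    (hC : ∀ a, ‖Ψ a‖ ≤ C) (a : Fin m → Γ) : StrongDual ℝ (FinL1 K W) :=
  FinL1.lift (fun x => Ψ (s x • a)) fun _ => hC _

theorem eval_coinduce (s : K → Γ) {m : ℕ} (Ψ : (Fin m → Γ) → StrongDual ℝ W) {C : ℝ}
    (hC : ∀ a, ‖Ψ a‖ ≤ C) (a : Fin m → Γ) (x : K) :
    FinL1.eval x (coinduce s Ψ hC a) = Ψ (s x • a) :=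
  FinL1.eval_lift _ _ x

theorem norm_coinduce_le (s : K → Γ) {m : ℕ} (Ψ : (Fin m → Γ) → StrongDual ℝ W) {C : ℝ}
    (hC : ∀ a, ‖Ψ a‖ ≤ C) (a : Fin m → Γ) : ‖coinduce s Ψ hC a‖ ≤ C :=
  FinL1.norm_lift_le _ ((norm_nonneg _).trans (hC a)) _

theorem eval_homogeneousDelta {X : Type*} (x : K) {m : ℕ}
    (F : (Fin m → X) → StrongDual ℝ (FinL1 K W)) (a : Fin (m + 1) → X) :
    FinL1.eval x (homogeneousDelta F a) = homogeneousDelta (fun a' => FinL1.eval x (F a')) a :=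
  map_homogeneousDelta (FinL1.eval x) F a

theorem eval_homogeneousDelta_coinduce (s : K → Γ) {m : ℕ} (Ψ : (Fin m → Γ) → StrongDual ℝ W)
    {C : ℝ} (hC : ∀ a, ‖Ψ a‖ ≤ C) (a : Fin (m + 1) → Γ) (x : K) :
    FinL1.eval x (homogeneousDelta (coinduce s Ψ hC) a) = homogeneousDelta Ψ (s x • a) := by
  rw [eval_homogeneousDelta]
  simp only [eval_coinduce]
  rfl

theorem exists_norm_eval_toHomogeneous_le (x : K) {i : ℕ}
    (f : Cochain Γ (StrongDual ℝ (FinL1 K W)) i)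
    (ρ : NormedAction Γ (StrongDual ℝ (FinL1 K W))) :
    ∃ C, ∀ a, ‖FinL1.eval x (f.toHomogeneous ρ a)‖ ≤ C :=
  (f.exists_norm_toHomogeneous_le ρ).imp fun _ hC a => (FinL1.norm_eval_le _ _).trans (hC a)

theorem homogeneousDelta_eval_toHomogeneous (x : K) {i : ℕ}
    (f : Cochain Γ (StrongDual ℝ (FinL1 K W)) i)
    (ρ : NormedAction Γ (StrongDual ℝ (FinL1 K W))) (a : Fin (i + 2) → Γ) :
    homogeneousDelta (fun a' => FinL1.eval x (f.toHomogeneous ρ a')) a =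
      FinL1.eval x ((delta ρ i f).toHomogeneous ρ a) := by
  rw [← eval_homogeneousDelta, homogeneousDelta_toHomogeneous]

end Coinduction

/-! ### Shapiro's argument for the kernel of φ -/

section Shapiro

variable {Γ : Type u} {K : Type v} [Group Γ] [Group K] {φ : Γ →* K}

theorem exists_section_map_one (hφ : Function.Surjective φ) :
    ∃ s : K → Γ, (∀ k, φ (s k) = k) ∧ s 1 = 1 := by
  classical
  refine ⟨Function.update (Function.surjInv hφ) 1 1, fun k => ?_, Function.update_self ..⟩
  by_cases hk : k = 1
  · rw [hk, Function.update_self, map_one]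
  · rw [Function.update_of_ne hk, Function.surjInv_eq hφ]

/-- The retraction of `Γ` onto the kernel of `φ` attached to a section of `φ`. -/
def kerRetraction (s : K → Γ) (hs : ∀ k, φ (s k) = k) (a : Γ) : φ.ker :=
  ⟨a * (s (φ a))⁻¹, by rw [MonoidHom.mem_ker, map_mul, map_inv, hs, mul_inv_cancel]⟩

theorem kerRetraction_mul (s : K → Γ) (hs : ∀ k, φ (s k) = k) (h : φ.ker) (a : Γ) :
    kerRetraction s hs (h * a) = h * kerRetraction s hs a := by
  have h1 : φ h = 1 := h.2
  refine Subtype.ext ?_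
  change h * a * (s (φ (h * a)))⁻¹ = h * (a * (s (φ a))⁻¹)
  rw [map_mul, h1, one_mul, mul_assoc]

theorem kerRetraction_coe (s : K → Γ) (hs : ∀ k, φ (s k) = k) (hs1 : s 1 = 1) (h : φ.ker) :
    kerRetraction s hs h = h := by
  have h1 : φ h = 1 := h.2
  refine Subtype.ext ?_
  change h * (s (φ h))⁻¹ = (h : Γ)
  rw [h1, hs1, inv_one, mul_one]

variable {W : Type w} [NormedAddCommGroup W] [NormedSpace ℝ W]

/-- The elements s(x)g and s(x φ(g)) have the same image in K, so they differ by left multiplication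
by an element of H, to which Ψ is insensitive. -/
theorem isHomogeneous_coinduce {s : K → Γ} (hs : ∀ k, φ (s k) = k) {m : ℕ}
    {Ψ : (Fin m → Γ) → StrongDual ℝ W} {C : ℝ} (hC : ∀ a, ‖Ψ a‖ ≤ C)
    (hΨ : ∀ h ∈ φ.ker, ∀ a, Ψ (h • a) = Ψ a) :
    IsHomogeneous (restrict φ (dualAction (FinL1.translation K W))) (coinduce s Ψ hC) := by
  intro g a
  refine FinL1.ext_eval fun x => ?_
  change _ = FinL1.eval x (dualAction (FinL1.translation K W) (φ g) (coinduce s Ψ hC a))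
  rw [FinL1.eval_dualAction, eval_coinduce, eval_coinduce,
    ← hΨ (s x * g * (s (x * φ g))⁻¹) (by simp [MonoidHom.mem_ker, hs]) (s (x * φ g) • a),
    smul_smul, smul_smul, inv_mul_cancel_right]

/-- The value at 1 determines all other values, and it is H-invariant because φ is trivial on H. -/
theorem eval_one_toHomogeneous_smul {n : ℕ} (f : Cochain Γ (StrongDual ℝ (FinL1 K W)) n) (g : Γ)
    (a : Fin (n + 1) → Γ) :
    FinL1.eval 1 (f.toHomogeneous (restrict φ (dualAction (FinL1.translation K W))) (g • a)) =
      FinL1.eval (φ g)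
        (f.toHomogeneous (restrict φ (dualAction (FinL1.translation K W))) a) := by
  rw [f.isHomogeneous_toHomogeneous]
  change FinL1.eval 1 (dualAction (FinL1.translation K W) (φ g) _) = _
  rw [FinL1.eval_dualAction, one_mul]

/-- Coinducing an H-invariant primitive of the value at 1 gives an equivariant primitive of the
whole cochain. -/
theorem exists_delta_eq_of_eval (hφ : Function.Surjective φ) {i : ℕ}
    (f : Cochain Γ (StrongDual ℝ (FinL1 K W)) (i + 1))
    (Ψ : (Fin (i + 1) → Γ) → StrongDual ℝ W) (hb : ∃ C, ∀ a, ‖Ψ a‖ ≤ C)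
    (hΨ : ∀ h ∈ φ.ker, ∀ a, Ψ (h • a) = Ψ a)
    (hd : ∀ a, homogeneousDelta Ψ a = FinL1.eval 1
      (f.toHomogeneous (restrict φ (dualAction (FinL1.translation K W))) a)) :
    ∃ b, delta (restrict φ (dualAction (FinL1.translation K W))) i b = f := by
  obtain ⟨s, hs, -⟩ := exists_section_map_one hφ
  obtain ⟨C, hC⟩ := hb
  refine exists_delta_eq_of_homogeneous f (isHomogeneous_coinduce hs hC hΨ)
    ⟨C, norm_coinduce_le s Ψ hC⟩ (funext fun a => FinL1.ext_eval fun x => ?_)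
  rw [eval_homogeneousDelta_coinduce, hd, eval_one_toHomogeneous_smul, hs]

/-- `H^i_b(K; ℓ^∞(K, W')) = 0` for `i > 0`. -/
theorem exists_delta_eq_translation {i : ℕ} (f : Cochain K (StrongDual ℝ (FinL1 K W)) (i + 1))
    (hf : delta (dualAction (FinL1.translation K W)) (i + 1) f = 0) :
    ∃ b, delta (dualAction (FinL1.translation K W)) i b = f := by
  set ρ := dualAction (FinL1.translation K W)
  obtain ⟨C, hC⟩ := exists_norm_eval_toHomogeneous_le 1 f ρ
  -- For the identity of K the kernel is trivial, so the primitive need not be invariant and coning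
  -- with apex 1 works.
  refine exists_delta_eq_of_eval (φ := MonoidHom.id K) Function.surjective_id f
    (fun a => FinL1.eval 1 (f.toHomogeneous ρ (Fin.cons 1 a : Fin (i + 2) → K)))
    ⟨C, fun a => hC _⟩ (fun h hh a => ?_) fun a => ?_
  · rw [show h = 1 from hh, one_smul]
  · have h := homogeneousDelta_eval_toHomogeneous 1 f ρ (Fin.cons 1 a)
    rw [hf, toHomogeneous_zero, Pi.zero_apply, map_zero, homogeneousDelta_cons] at h
    exact (sub_eq_zero.1 h).symm

theorem toHomogeneous_ofHomogeneous {G : Type*} [Group G] {V : Type*} [NormedAddCommGroup V]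
    [NormedSpace ℝ V] {ρ : NormedAction G V} {n : ℕ} {Φ : (Fin (n + 1) → G) → V}
    (hΦ : IsHomogeneous ρ Φ) (hb : ∃ C, ∀ a, ‖Φ a‖ ≤ C) :
    (ofHomogeneous Φ hb).toHomogeneous ρ = Φ :=
  ((ofHomogeneous Φ hb).isHomogeneous_toHomogeneous ρ).ext hΦ fun g => by
    rw [toHomogeneous_partialProd, ofHomogeneous_apply]

theorem prism_zero {X V : Type*} [NormedAddCommGroup V] (q : X → X) (m : ℕ) :
    prism q m (0 : (Fin (m + 1) → X) → V) = 0 := by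
  have h := prism_sub q m (0 : (Fin (m + 1) → X) → V) 0
  simp only [sub_self] at h
  exact h

/-- If the kernel of `φ` is boundedly `n`-acyclic, then `H^i_b(Γ; ℓ^∞(K, W')) = 0` for
`0 < i ≤ n`. -/
theorem IsBoundedlyAcyclic.exists_delta_eq_translation {n : ℕ∞} (h : IsBoundedlyAcyclic φ.ker n)
    (hφ : Function.Surjective φ) (i : ℕ) (hi : ((i + 1 : ℕ) : ℕ∞) ≤ n)
    (f : Cochain Γ (StrongDual ℝ (FinL1 K W)) (i + 1))
    (hf : delta (restrict φ (dualAction (FinL1.translation K W))) (i + 1) f = 0) :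
    ∃ b, delta (restrict φ (dualAction (FinL1.translation K W))) i b = f := by
  obtain ⟨s, hs, -⟩ := exists_section_map_one hφ
  set ρ := restrict φ (dualAction (FinL1.translation K W))
  let Φ : (Fin (i + 2) → Γ) → StrongDual ℝ W := fun a => FinL1.eval 1 (f.toHomogeneous ρ a)
  obtain ⟨C, hC⟩ : ∃ C, ∀ a, ‖Φ a‖ ≤ C := exists_norm_eval_toHomogeneous_le 1 f ρ
  have hΦd : homogeneousDelta Φ = 0 := by
    funext a
    refine (homogeneousDelta_eval_toHomogeneous 1 f ρ a).trans ?_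
    rw [hf, toHomogeneous_zero, Pi.zero_apply, map_zero]
    rfl
  have hΦ : ∀ h ∈ φ.ker, ∀ a, Φ (h • a) = Φ a := fun h hh a => by
    refine (eval_one_toHomogeneous_smul f h a).trans ?_
    rw [show φ h = 1 from hh]
  let Φ' : (Fin (i + 2) → φ.ker) → StrongDual ℝ W := fun a => Φ (Subtype.val ∘ a)
  have hΦ' : IsHomogeneous (1 : NormedAction φ.ker (StrongDual ℝ W)) Φ' :=
    fun h a => hΦ h h.2 (Subtype.val ∘ a)
  have hb' : ∃ C, ∀ a, ‖Φ' a‖ ≤ C := ⟨C, fun a => hC _⟩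
  obtain ⟨b, hb⟩ := h.exists_delta_eq i hi (ofHomogeneous Φ' hb') (Cochain.ext fun g => by
    rw [delta_ofHomogeneous hΦ']
    exact congrFun hΦd (Subtype.val ∘ Fin.partialProd g))
  have hβ : homogeneousDelta (b.toHomogeneous 1) = Φ' := by
    rw [homogeneousDelta_toHomogeneous, hb, toHomogeneous_ofHomogeneous hΦ']
  obtain ⟨D, hD⟩ := b.exists_norm_toHomogeneous_le (1 : NormedAction φ.ker (StrongDual ℝ W))
  let r : Γ → φ.ker := kerRetraction s hs
  let q : Γ → Γ := fun a => r a
  -- As Φ is closed, Φ − Φ ∘ q is the coboundary of its prism, while Φ ∘ q is the pullback along r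
  -- of Φ', which has primitive b on H. Both summands are H-invariant because r is H-equivariant.
  refine exists_delta_eq_of_eval hφ f
    (prism q (i + 1) Φ + fun a => b.toHomogeneous 1 (r ∘ a))
    ⟨(i + 1 : ℕ) * C + D, fun a => (norm_add_le _ _).trans
      (add_le_add (norm_prism_le q (i + 1) hC a) (hD _))⟩ (fun h hh a => ?_) fun a => ?_
  · have hr : ∀ x, r (h * x) = ⟨h, hh⟩ * r x := kerRetraction_mul s hs ⟨h, hh⟩
    have h1 : prism q (i + 1) Φ (h • a) = prism q (i + 1) Φ a := by
      refine (prism_comp (t := fun x => h * x) (fun x => ?_) (i + 1) Φ a).trans ?_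
      · exact congrArg Subtype.val (hr x)
      · exact congrArg (fun Ψ => prism q (i + 1) Ψ a) (funext (hΦ h hh))
    have h2 : r ∘ (h • a) = (⟨h, hh⟩ : φ.ker) • (r ∘ a) := funext fun j => hr (a j)
    rw [Pi.add_apply, Pi.add_apply, h1, h2, b.isHomogeneous_toHomogeneous]
    rfl
  · have h1 := homogeneousDelta_prism_add q (i + 1) Φ a
    rw [hΦd, prism_zero, Pi.zero_apply, add_zero] at h1
    have h2 : homogeneousDelta (fun a' => b.toHomogeneous 1 (r ∘ a')) a = Φ (q ∘ a) :=
      congrFun hβ (r ∘ a)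
    rw [homogeneousDelta_add, Pi.add_apply, h1, h2, sub_add_cancel]

/-- If `H^i_b(Γ; ℓ^∞(K, W')) = 0`, then `H^i_b(ker φ; W') = 0`. -/
theorem exists_delta_eq_ker (hφ : Function.Surjective φ) (i : ℕ)
    (h : ∀ f : Cochain Γ (StrongDual ℝ (FinL1 K W)) (i + 1),
      delta (restrict φ (dualAction (FinL1.translation K W))) (i + 1) f = 0 →
      ∃ b, delta (restrict φ (dualAction (FinL1.translation K W))) i b = f)
    (z : Cochain φ.ker (StrongDual ℝ W) (i + 1)) (hz : delta 1 (i + 1) z = 0) :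
    ∃ b, delta (1 : NormedAction φ.ker (StrongDual ℝ W)) i b = z := by
  obtain ⟨s, hs, hs1⟩ := exists_section_map_one hφ
  set ρ := restrict φ (dualAction (FinL1.translation K W))
  let r : Γ → φ.ker := kerRetraction s hs
  -- Pulling z back along the retraction gives an H-invariant cocycle on Γ, ready to be coinduced.
  let Φ : (Fin (i + 2) → Γ) → StrongDual ℝ W := fun a => z.toHomogeneous 1 (r ∘ a)
  obtain ⟨C, hC⟩ : ∃ C, ∀ a, ‖Φ a‖ ≤ C :=
    (z.exists_norm_toHomogeneous_le 1).imp fun _ hC a => hC _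
  have hΦd : ∀ a, homogeneousDelta Φ a = 0 := fun a => by
    refine (congrFun (homogeneousDelta_toHomogeneous 1 z) (r ∘ a)).trans ?_
    rw [hz, toHomogeneous_zero]
    rfl
  have hΦ : ∀ h ∈ φ.ker, ∀ a, Φ (h • a) = Φ a := fun h hh a => by
    have h2 : r ∘ (h • a) = (⟨h, hh⟩ : φ.ker) • (r ∘ a) :=
      funext fun j => kerRetraction_mul s hs ⟨h, hh⟩ (a j)
    change z.toHomogeneous 1 (r ∘ (h • a)) = _
    rw [h2, z.isHomogeneous_toHomogeneous]
    rfl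
  have hF : IsHomogeneous ρ (coinduce s Φ hC) := isHomogeneous_coinduce hs hC hΦ
  have hFb : ∃ C, ∀ a, ‖coinduce s Φ hC a‖ ≤ C := ⟨C, norm_coinduce_le s Φ hC⟩
  obtain ⟨b, hb⟩ := h (ofHomogeneous _ hFb) (Cochain.ext fun g => by
    rw [delta_ofHomogeneous hF]
    refine FinL1.ext_eval fun x => ?_
    rw [eval_homogeneousDelta_coinduce, hΦd]
    exact (map_zero (FinL1.eval x)).symm)
  obtain ⟨D, hD⟩ := exists_norm_eval_toHomogeneous_le 1 b ρ
  refine exists_delta_eq_of_homogeneous z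
    (Ψ := fun a => FinL1.eval 1 (b.toHomogeneous ρ (Subtype.val ∘ a))) (fun h a => ?_)
    ⟨D, fun a => hD _⟩ (funext fun a => ?_)
  · refine (eval_one_toHomogeneous_smul b h (Subtype.val ∘ a)).trans ?_
    rw [show φ h = 1 from h.2]
    rfl
  · refine (homogeneousDelta_eval_toHomogeneous 1 b ρ (Subtype.val ∘ a)).trans ?_
    -- The normalization s(1) = 1 is needed here: it makes r the identity on H, so that restriction
    -- returns z itself.
    rw [hb, toHomogeneous_ofHomogeneous hF, eval_coinduce, hs1, one_smul]
    refine congrArg (z.toHomogeneous 1) (funext fun j => ?_)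
    exact kerRetraction_coe s hs hs1 (a j)

end Shapiro

/-! ### Functoriality in the coefficients -/

theorem Cochain.postcomp_sub {S V V' : Type*} [NormedAddCommGroup V] [NormedSpace ℝ V]
    [NormedAddCommGroup V'] [NormedSpace ℝ V'] (T : V →L[ℝ] V') {n : ℕ} (f g : Cochain S V n) :
    (f - g).postcomp T = f.postcomp T - g.postcomp T :=
  Cochain.ext fun x => map_sub T (f x) (g x)

theorem Cochain.postcomp_zero {S V V' : Type*} [NormedAddCommGroup V] [NormedSpace ℝ V]
    [NormedAddCommGroup V'] [NormedSpace ℝ V'] (T : V →L[ℝ] V') {n : ℕ} :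
    (0 : Cochain S V n).postcomp T = 0 :=
  Cochain.ext fun _ => map_zero T

theorem cochainMap_postcomp {Γ K V V' : Type*} [Group Γ] [Group K] [NormedAddCommGroup V]
    [NormedSpace ℝ V] [NormedAddCommGroup V'] [NormedSpace ℝ V'] (φ : Γ →* K) (T : V →L[ℝ] V')
    {n : ℕ} (f : Cochain K V n) :
    cochainMap φ n (f.postcomp T) = (cochainMap φ n f).postcomp T := rfl

theorem postcomp_mem_coboundaries {G V V' : Type*} [Group G] [NormedAddCommGroup V]
    [NormedSpace ℝ V] [NormedAddCommGroup V'] [NormedSpace ℝ V'] {ρ : NormedAction G V}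
    {ρ' : NormedAction G V'} {T : V →L[ℝ] V'} (hT : IsEquivariant ρ ρ' T) {n : ℕ}
    {f : Cochain G V n} (hf : f ∈ coboundaries ρ n) : f.postcomp T ∈ coboundaries ρ' n := by
  cases n with
  | zero => rw [show f = 0 from hf, Cochain.postcomp_zero]; exact Submodule.zero_mem _
  | succ n =>
    obtain ⟨b, rfl⟩ := hf
    exact ⟨b.postcomp T, delta_postcomp hT b⟩

/-- The transpose of a bounded linear map. -/
def dualMap {E F : Type*} [NormedAddCommGroup E] [NormedSpace ℝ E] [NormedAddCommGroup F]
    [NormedSpace ℝ F] (T : E →L[ℝ] F) : StrongDual ℝ F →L[ℝ] StrongDual ℝ E :=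
  (ContinuousLinearMap.compL ℝ E F ℝ).flip T

@[simp]
theorem dualMap_apply {E F : Type*} [NormedAddCommGroup E] [NormedSpace ℝ E]
    [NormedAddCommGroup F] [NormedSpace ℝ F] (T : E →L[ℝ] F) (f : StrongDual ℝ F) (x : E) :
    dualMap T f x = f (T x) := rfl

theorem IsEquivariant.dualMap {G E F : Type*} [Group G] [NormedAddCommGroup E] [NormedSpace ℝ E]
    [NormedAddCommGroup F] [NormedSpace ℝ F] {ρ : NormedAction G E} {ρ' : NormedAction G F}
    {T : E →L[ℝ] F} (hT : IsEquivariant ρ ρ' T) :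
    IsEquivariant (dualAction ρ') (dualAction ρ) (dualMap T) := fun g f => by
  ext x
  rw [dualMap_apply, dualAction_apply, dualAction_apply, dualMap_apply, hT]

theorem IsEquivariant.restrict {Γ K V V' : Type*} [Group Γ] [Group K] [NormedAddCommGroup V]
    [NormedSpace ℝ V] [NormedAddCommGroup V'] [NormedSpace ℝ V'] {ρ : NormedAction K V}
    {ρ' : NormedAction K V'} {T : V →L[ℝ] V'} (hT : IsEquivariant ρ ρ' T) (φ : Γ →* K) :
    IsEquivariant (restrict φ ρ) (restrict φ ρ') T := fun g a => hT (φ g) a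

/-- The cochain of degree zero given by an element of the module. -/
def Cochain.const (S : Type*) {V : Type*} [NormedAddCommGroup V] [NormedSpace ℝ V] (v : V) :
    Cochain S V 0 :=
  ⟨fun _ => v, ‖v‖, fun _ => le_rfl⟩

@[simp]
theorem Cochain.const_apply {S V : Type*} [NormedAddCommGroup V] [NormedSpace ℝ V] (v : V)
    (x : Fin 0 → S) : Cochain.const S v x = v := rfl

/-! ### Dimension shifting along 0 → W' → ℓ^∞(K, W') → Q → 0 -/

section DimensionShifting

variable {K : Type v} [Group K] {W : Type w} [NormedAddCommGroup W] [NormedSpace ℝ W]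

/-- Evaluation at the neutral element, a retraction of `dualMap (action ρ)`. -/
def evalOne (K : Type v) [Group K] (W : Type w) [NormedAddCommGroup W] [NormedSpace ℝ W] :
    StrongDual ℝ (FinL1 K W) →L[ℝ] StrongDual ℝ W :=
  LinearMap.mkContinuous (FinL1.eval 1) 1 fun F => by
    rw [one_mul]
    exact FinL1.norm_eval_le 1 F

theorem norm_evalOne_le : ‖evalOne K W‖ ≤ 1 :=
  LinearMap.mkContinuous_norm_le _ zero_le_one _

theorem evalOne_apply (F : StrongDual ℝ (FinL1 K W)) (w : W) :
    evalOne K W F w = F (FinL1.single 1 w) := rfl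

theorem evalOne_dualMap_action (ρ : NormedAction K W) (f : StrongDual ℝ W) :
    evalOne K W (dualMap (FinL1.action ρ) f) = f := by
  ext w
  rw [evalOne_apply, dualMap_apply, FinL1.action_single, inv_one, map_one]
  rfl

/-- The action of `K` on the kernel of `ℓ¹(K, W) → W`. -/
def kernelAction (ρ : NormedAction K W) : NormedAction K (FinL1.action ρ).ker where
  toFun k :=
    { toFun := fun x => ⟨FinL1.translation K W k x, by
        have h : FinL1.action ρ x = 0 := x.2
        change FinL1.action ρ (FinL1.translation K W k x) = 0
        rw [FinL1.isEquivariant_action, h, map_zero]⟩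
      invFun := fun x => ⟨FinL1.translation K W k⁻¹ x, by
        have h : FinL1.action ρ x = 0 := x.2
        change FinL1.action ρ (FinL1.translation K W k⁻¹ x) = 0
        rw [FinL1.isEquivariant_action, h, map_zero]⟩
      map_add' := fun x y => Subtype.ext (map_add (FinL1.translation K W k) x.1 y.1)
      map_smul' := fun c x => Subtype.ext (map_smul (FinL1.translation K W k) c x.1)
      left_inv := fun x => Subtype.ext (by
        change (FinL1.translation K W k⁻¹ * FinL1.translation K W k) x.1 = x
        rw [← map_mul, inv_mul_cancel, map_one]
        rfl)
      right_inv := fun x => Subtype.ext (by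
        change (FinL1.translation K W k * FinL1.translation K W k⁻¹) x.1 = x
        rw [← map_mul, mul_inv_cancel, map_one]
        rfl)
      norm_map' := fun x => (FinL1.translation K W k).norm_map x.1 }
  map_one' := LinearIsometryEquiv.ext fun x => Subtype.ext (by
    change FinL1.translation K W 1 x.1 = x
    rw [map_one]
    rfl)
  map_mul' k l := LinearIsometryEquiv.ext fun x => Subtype.ext (by
    change FinL1.translation K W (k * l) x.1 = FinL1.translation K W k (FinL1.translation K W l x.1)
    rw [map_mul]
    rfl)

/-- The projection of `ℓ^∞(K, W')` onto the dual of the kernel of `ℓ¹(K, W) → W`. -/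
def toKernelDual (ρ : NormedAction K W) :
    StrongDual ℝ (FinL1 K W) →L[ℝ] StrongDual ℝ (FinL1.action ρ).ker :=
  dualMap (FinL1.action ρ).ker.subtypeL

theorem isEquivariant_toKernelDual (ρ : NormedAction K W) :
    IsEquivariant (dualAction (FinL1.translation K W)) (dualAction (kernelAction ρ))
      (toKernelDual ρ) :=
  IsEquivariant.dualMap (ρ := kernelAction ρ) fun _ _ => rfl

theorem isEquivariant_dualMap_action (ρ : NormedAction K W) :
    IsEquivariant (dualAction ρ) (dualAction (FinL1.translation K W))
      (dualMap (FinL1.action ρ)) :=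
  (FinL1.isEquivariant_action ρ).dualMap

theorem toKernelDual_dualMap_action (ρ : NormedAction K W) (f : StrongDual ℝ W) :
    toKernelDual ρ (dualMap (FinL1.action ρ) f) = 0 := by
  ext x
  exact (congrArg f x.2).trans (map_zero f)

/-- Exactness in the middle: ξ and the point mass at 1 with value `action ρ ξ` differ by an element
of the kernel, on which F vanishes. -/
theorem dualMap_action_evalOne (ρ : NormedAction K W) {F : StrongDual ℝ (FinL1 K W)}
    (hF : toKernelDual ρ F = 0) : dualMap (FinL1.action ρ) (evalOne K W F) = F := by
  ext ξ
  have h : FinL1.single 1 (FinL1.action ρ ξ) - ξ ∈ (FinL1.action ρ).ker := by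
    change FinL1.action ρ _ = 0
    rw [map_sub, FinL1.action_single, inv_one, map_one]
    exact sub_self _
  have h1 : F (FinL1.single 1 (FinL1.action ρ ξ) - ξ) = 0 := congrArg (fun f => f ⟨_, h⟩) hF
  rw [map_sub] at h1
  exact sub_eq_zero.1 h1

variable {S : Type*} {m : ℕ}

theorem postcomp_dualMap_action_injective (ρ : NormedAction K W)
    {f g : Cochain S (StrongDual ℝ W) m}
    (h : f.postcomp (dualMap (FinL1.action ρ)) = g.postcomp (dualMap (FinL1.action ρ))) :
    f = g := by
  refine Cochain.ext fun x => ?_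
  rw [← evalOne_dualMap_action ρ (f x), ← evalOne_dualMap_action ρ (g x)]
  exact congrArg (fun c : Cochain S _ m => evalOne K W (c x)) h

theorem exists_postcomp_dualMap_action_eq (ρ : NormedAction K W)
    {c : Cochain S (StrongDual ℝ (FinL1 K W)) m}
    (hc : c.postcomp (V' := StrongDual ℝ (FinL1.action ρ).ker) (toKernelDual ρ) = 0) :
    ∃ f : Cochain S (StrongDual ℝ W) m, f.postcomp (dualMap (FinL1.action ρ)) = c :=
  ⟨c.postcomp (evalOne K W), Cochain.ext fun x => dualMap_action_evalOne ρ
    (congrArg (fun c : Cochain S _ m => c x) hc)⟩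

/-- Norm-preserving Hahn–Banach extension at each point keeps the cochain bounded. The choice need
be neither linear nor equivariant. -/
theorem exists_postcomp_toKernelDual_eq (ρ : NormedAction K W)
    (f : Cochain S (StrongDual ℝ (FinL1.action ρ).ker) m) :
    ∃ c : Cochain S (StrongDual ℝ (FinL1 K W)) m, c.postcomp (toKernelDual ρ) = f := by
  choose g hg hgn using fun x => exists_extension_norm_eq (FinL1.action ρ).ker (f x)
  obtain ⟨C, hC⟩ := f.2
  exact ⟨⟨g, C, fun x => (hgn x).trans_le (hC x)⟩,
    Cochain.ext fun x => ContinuousLinearMap.ext fun w => hg x w⟩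

/-- A primitive is lifted, so the lift remains a coboundary; in degree 0 the only coboundary is
zero. -/
theorem exists_mem_coboundaries_postcomp_toKernelDual_eq {G : Type*} [Group G] (φ : G →* K)
    (ρ : NormedAction K W) {f : Cochain G (StrongDual ℝ (FinL1.action ρ).ker) m}
    (hf : f ∈ coboundaries (restrict φ (dualAction (kernelAction ρ))) m) :
    ∃ c ∈ coboundaries (restrict φ (dualAction (FinL1.translation K W))) m,
      c.postcomp (toKernelDual ρ) = f := by
  cases m with
  | zero => exact ⟨0, Submodule.zero_mem _, Cochain.postcomp_zero _ |>.trans (Eq.symm hf)⟩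
  | succ m =>
    obtain ⟨b, rfl⟩ := hf
    obtain ⟨c, rfl⟩ := exists_postcomp_toKernelDual_eq ρ b
    exact ⟨_, ⟨c, rfl⟩, (delta_postcomp ((isEquivariant_toKernelDual ρ).restrict φ) c).symm⟩

/-- The restriction map along `φ` is surjective on degree `m` cohomology, in terms of cochains. -/
def RestrictionSurjective {Γ : Type u} [Group Γ] (φ : Γ →* K) {V : Type*} [NormedAddCommGroup V]
    [NormedSpace ℝ V] (ρ : NormedAction K V) (m : ℕ) : Prop :=
  ∀ z : Cochain Γ V m, delta (restrict φ ρ) m z = 0 →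
    ∃ f : Cochain K V m, delta ρ m f = 0 ∧ z - cochainMap φ m f ∈ coboundaries (restrict φ ρ) m

/-- The restriction map along `φ` is injective on degree `m` cohomology, in terms of cochains. -/
def RestrictionInjective {Γ : Type u} [Group Γ] (φ : Γ →* K) {V : Type*} [NormedAddCommGroup V]
    [NormedSpace ℝ V] (ρ : NormedAction K V) (m : ℕ) : Prop :=
  ∀ f : Cochain K V m, delta ρ m f = 0 →
    cochainMap φ m f ∈ coboundaries (restrict φ ρ) m → f ∈ coboundaries ρ m

theorem restrictionSurjective_iff {Γ : Type u} [Group Γ] (φ : Γ →* K) {V : Type*}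
    [NormedAddCommGroup V] [NormedSpace ℝ V] (ρ : NormedAction K V) (m : ℕ) :
    Function.Surjective (cohomologyMap φ ρ m) ↔ RestrictionSurjective φ ρ m := by
  constructor
  · intro h z hz
    obtain ⟨c, hc⟩ := h (Submodule.Quotient.mk ⟨z, hz⟩)
    obtain ⟨f, rfl⟩ := Submodule.Quotient.mk_surjective _ c
    exact ⟨f, f.2, (Submodule.Quotient.eq
      ((coboundaries (restrict φ ρ) m).submoduleOf (cocycles (restrict φ ρ) m))).1 hc.symm⟩
  · intro h c
    obtain ⟨z, rfl⟩ := Submodule.Quotient.mk_surjective _ c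
    obtain ⟨f, hf, hzf⟩ := h z z.2
    exact ⟨Submodule.Quotient.mk ⟨f, hf⟩, ((Submodule.Quotient.eq
      ((coboundaries (restrict φ ρ) m).submoduleOf (cocycles (restrict φ ρ) m))).2 hzf).symm⟩

theorem restrictionInjective_iff {Γ : Type u} [Group Γ] (φ : Γ →* K) {V : Type*}
    [NormedAddCommGroup V] [NormedSpace ℝ V] (ρ : NormedAction K V) (m : ℕ) :
    Function.Injective (cohomologyMap φ ρ m) ↔ RestrictionInjective φ ρ m := by
  rw [injective_iff_map_eq_zero]
  constructor
  · intro h f hf hφf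
    exact (Submodule.Quotient.mk_eq_zero ((coboundaries ρ m).submoduleOf (cocycles ρ m))).1
      (h (Submodule.Quotient.mk ⟨f, hf⟩) ((Submodule.Quotient.mk_eq_zero _).2 hφf))
  · intro h c hc
    obtain ⟨f, rfl⟩ := Submodule.Quotient.mk_surjective _ c
    exact (Submodule.Quotient.mk_eq_zero ((coboundaries ρ m).submoduleOf (cocycles ρ m))).2
      (h f f.2 ((Submodule.Quotient.mk_eq_zero
        ((coboundaries (restrict φ ρ) m).submoduleOf (cocycles (restrict φ ρ) m))).1 hc))

variable {Γ : Type u} [Group Γ] {φ : Γ →* K}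

/-- Four lemma: H^{m+1}_b(Γ; I) = 0 makes the connecting map from H^m_b(Γ; Q) onto, and restriction
commutes with connecting maps. -/
theorem RestrictionSurjective.succ {ρ : NormedAction K W}
    (hI : ∀ z : Cochain Γ (StrongDual ℝ (FinL1 K W)) (m + 1),
      delta (restrict φ (dualAction (FinL1.translation K W))) (m + 1) z = 0 →
      ∃ b, delta (restrict φ (dualAction (FinL1.translation K W))) m b = z)
    (hQ : RestrictionSurjective φ (dualAction (kernelAction ρ)) m) :
    RestrictionSurjective φ (dualAction ρ) (m + 1) := by
  intro z hz
  have hj := isEquivariant_dualMap_action ρ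
  have hπ := isEquivariant_toKernelDual ρ
  obtain ⟨b, hb⟩ := hI (z.postcomp (dualMap (FinL1.action ρ))) (by
    rw [delta_postcomp (hj.restrict φ), hz, Cochain.postcomp_zero])
  obtain ⟨q, hq, hbq⟩ := hQ (b.postcomp (toKernelDual ρ)) (by
    rw [delta_postcomp (hπ.restrict φ), hb]
    exact Cochain.ext fun x => toKernelDual_dualMap_action ρ (z x))
  obtain ⟨c, rfl⟩ := exists_postcomp_toKernelDual_eq ρ q
  obtain ⟨y, hy, hyq⟩ := exists_mem_coboundaries_postcomp_toKernelDual_eq φ ρ hbq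
  have hy0 : delta (restrict φ (dualAction (FinL1.translation K W))) m y = 0 :=
    coboundaries_le_cocycles _ _ hy
  -- Over Q, b agrees with the restriction of c up to the coboundary y, so the difference comes from
  -- W'.
  obtain ⟨a, ha⟩ := exists_postcomp_dualMap_action_eq ρ (c := b - cochainMap φ m c - y) (by
    rw [Cochain.postcomp_sub, Cochain.postcomp_sub, hyq, cochainMap_postcomp, sub_self])
  obtain ⟨f, hf⟩ := exists_postcomp_dualMap_action_eq ρ
    (c := delta (dualAction (FinL1.translation K W)) m c) (by rw [← delta_postcomp hπ, hq])
  refine ⟨f, postcomp_dualMap_action_injective ρ ?_, a, postcomp_dualMap_action_injective ρ ?_⟩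
  · rw [← delta_postcomp hj, hf, delta_delta, Cochain.postcomp_zero]
  · rw [← delta_postcomp (hj.restrict φ), ha, map_sub, map_sub, hy0, sub_zero, hb,
      delta_cochainMap, ← hf, Cochain.postcomp_sub, cochainMap_postcomp]

/-- Four lemma: H^{m+1}_b(K; I) = 0 always, so degree m suffices, with surjectivity for I and
injectivity for Q. -/
theorem RestrictionInjective.succ {ρ : NormedAction K W}
    (hI : RestrictionSurjective φ (dualAction (FinL1.translation K W)) m)
    (hQ : RestrictionInjective φ (dualAction (kernelAction ρ)) m) :
    RestrictionInjective φ (dualAction ρ) (m + 1) := by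
  rintro f hf ⟨b, hb⟩
  have hj := isEquivariant_dualMap_action ρ
  have hπ := isEquivariant_toKernelDual ρ
  obtain ⟨c, hc⟩ := exists_delta_eq_translation (f.postcomp (dualMap (FinL1.action ρ))) (by
    rw [delta_postcomp hj, hf, Cochain.postcomp_zero])
  -- The restriction of c and the image of b are primitives of the same cocycle over Γ; a cocycle y
  -- on K corrects c so that they agree up to a coboundary.
  obtain ⟨y, hy, hyb⟩ := hI (cochainMap φ m c - b.postcomp (dualMap (FinL1.action ρ))) (by
    rw [map_sub, delta_cochainMap, hc, delta_postcomp (hj.restrict φ), hb, cochainMap_postcomp,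
      sub_self])
  have hcy : delta (dualAction (FinL1.translation K W)) m (c - y) =
      f.postcomp (dualMap (FinL1.action ρ)) := by rw [map_sub, hc, hy, sub_zero]
  have hcob : (c - y).postcomp (toKernelDual ρ) ∈ coboundaries (dualAction (kernelAction ρ)) m := by
    refine hQ _ ?_ ?_
    · rw [delta_postcomp hπ, hcy]
      exact Cochain.ext fun x => toKernelDual_dualMap_action ρ (f x)
    · have h := postcomp_mem_coboundaries (hπ.restrict φ) hyb
      have hjb : (b.postcomp (dualMap (FinL1.action ρ))).postcomp
          (V' := StrongDual ℝ (FinL1.action ρ).ker) (toKernelDual ρ) = 0 :=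
        Cochain.ext fun x => toKernelDual_dualMap_action ρ (b x)
      rw [Cochain.postcomp_sub, Cochain.postcomp_sub, hjb, sub_zero, ← Cochain.postcomp_sub,
        ← map_sub, ← cochainMap_postcomp] at h
      exact h
  -- Restriction along the identity of K changes nothing, so the lifting lemma for Γ also serves
  -- over K.
  obtain ⟨e, he, hec⟩ := exists_mem_coboundaries_postcomp_toKernelDual_eq (MonoidHom.id K) ρ hcob
  have he0 : delta (dualAction (FinL1.translation K W)) m e = 0 :=
    coboundaries_le_cocycles _ _ he
  obtain ⟨a, ha⟩ := exists_postcomp_dualMap_action_eq ρ (c := c - y - e) (by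
    rw [Cochain.postcomp_sub, hec, sub_self])
  refine ⟨a, postcomp_dualMap_action_injective ρ ?_⟩
  rw [← delta_postcomp hj, ha, map_sub, hcy, he0, sub_zero]

/-- Degree 0 is the space of invariants, and Γ-invariants are K-invariant when φ is onto. -/
theorem restrictionSurjective_zero (hφ : Function.Surjective φ) {V : Type*}
    [NormedAddCommGroup V] [NormedSpace ℝ V] (ρ : NormedAction K V) :
    RestrictionSurjective φ ρ 0 := by
  intro z hz
  refine ⟨Cochain.const K (z default), Cochain.ext fun g => ?_, ?_⟩
  · obtain ⟨a, ha⟩ := hφ (g 0)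
    rw [delta_zero_apply, ← ha, Cochain.const_apply]
    have h := delta_zero_apply (restrict φ ρ) z fun _ => a
    rw [hz] at h
    exact h.symm
  · refine (sub_eq_zero.2 (Cochain.ext fun g => ?_) : z - _ = 0)
    exact congrArg z (Subsingleton.elim _ _)

theorem restrictionInjective_zero {V : Type*}
    [NormedAddCommGroup V] [NormedSpace ℝ V] (ρ : NormedAction K V) :
    RestrictionInjective φ ρ 0 := by
  intro f _ h
  refine (Cochain.ext fun g => ?_ : f = 0)
  refine (congrArg f (Subsingleton.elim _ _)).trans
    (congrArg (fun c : Cochain Γ V 0 => c default) (show cochainMap φ 0 f = 0 from h))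

end DimensionShifting

/-! ### The implications between the four conditions -/

section Characterization

variable {Γ : Type u} {K : Type v} [Group Γ] [Group K] {φ : Γ →* K}

/-- The induction ranges over all W because each step replaces W by the kernel of ℓ¹(K, W) → W; the
universe `max v w` is stable under this. -/
theorem IsBoundedlyAcyclic.restrictionSurjective {n : ℕ∞} (h : IsBoundedlyAcyclic φ.ker n)
    (hφ : Function.Surjective φ) (m : ℕ) (hm : (m : ℕ∞) ≤ n) (W : Type (max v w))
    [NormedAddCommGroup W] [NormedSpace ℝ W] (ρ : NormedAction K W) :
    RestrictionSurjective φ (dualAction ρ) m := by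
  induction m generalizing W with
  | zero => exact restrictionSurjective_zero hφ _
  | succ m ih =>
    exact .succ (h.exists_delta_eq_translation hφ m hm)
      (ih (le_trans (by exact_mod_cast m.le_succ) hm) _ _)

/-- Reaches degree n + 1 because the step to m + 1 uses surjectivity only in degree m. -/
theorem IsBoundedlyAcyclic.restrictionInjective {n : ℕ∞} (h : IsBoundedlyAcyclic φ.ker n)
    (hφ : Function.Surjective φ) (m : ℕ) (hm : (m : ℕ∞) ≤ n + 1) (W : Type (max v w))
    [NormedAddCommGroup W] [NormedSpace ℝ W] (ρ : NormedAction K W) :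
    RestrictionInjective φ (dualAction ρ) m := by
  induction m generalizing W with
  | zero => exact restrictionInjective_zero _
  | succ m ih =>
    have hm' : (m : ℕ∞) ≤ n := by
      push_cast at hm
      exact (ENat.add_le_add_iff_right ENat.one_ne_top).1 hm
    exact .succ (h.restrictionSurjective.{u, v, max v w} hφ m hm' _ _)
      (ih (le_trans (by exact_mod_cast m.le_succ) hm) _ _)

/-- The indicator function of φ(Γ), times a nonzero functional, is Γ-invariant. It must then be
K-invariant, hence constant on K. -/
theorem surjective_of_restrictionSurjective_zero {W : Type w} [NormedAddCommGroup W]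
    [NormedSpace ℝ W] [Nontrivial W]
    (h : RestrictionSurjective φ (dualAction (FinL1.translation K W)) 0) :
    Function.Surjective φ := by
  classical
  intro k
  obtain ⟨w, hw⟩ := exists_ne (0 : W)
  obtain ⟨e, -, he⟩ := exists_dual_vector ℝ w (norm_ne_zero_iff.2 hw)
  have hb : ∀ x : K, ‖if x ∈ φ.range then e else 0‖ ≤ ‖e‖ := fun x => by
    split_ifs
    · exact le_rfl
    · rw [norm_zero]; exact norm_nonneg e
  let F : StrongDual ℝ (FinL1 K W) := FinL1.lift _ hb
  have hF : ∀ x, FinL1.eval x F = if x ∈ φ.range then e else 0 := FinL1.eval_lift _ hb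
  obtain ⟨f, hf, hfz⟩ := h (Cochain.const Γ F) (Cochain.ext fun g => by
    rw [delta_zero_apply, Cochain.const_apply]
    refine sub_eq_zero.2 (FinL1.ext_eval fun x => ?_)
    refine (FinL1.eval_dualAction (φ (g 0)) x F).trans ?_
    rw [hF, hF]
    exact if_congr (φ.range.mul_mem_cancel_right ⟨g 0, rfl⟩) rfl rfl)
  have hfF : F = f default := by
    refine (congrArg (fun c : Cochain Γ _ 0 => c default) (sub_eq_zero.1 hfz)).trans ?_
    exact congrArg f (Subsingleton.elim _ _)
  have hinv := delta_zero_apply (dualAction (FinL1.translation K W)) f fun _ => k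
  rw [hf, ← hfF] at hinv
  have h1 : FinL1.eval 1 (dualAction (FinL1.translation K W) k F) = FinL1.eval 1 F :=
    congrArg _ (sub_eq_zero.1 hinv.symm)
  rw [FinL1.eval_dualAction, one_mul, hF, hF, if_pos φ.range.one_mem] at h1
  by_contra hk
  rw [if_neg (show k ∉ φ.range from hk)] at h1
  rw [← h1] at he
  exact hw (norm_eq_zero.1 (by simpa using he.symm))

/-- Bounded cohomology with relatively injective dual coefficients vanishes. -/
theorem IsRelativelyInjective.exists_delta_eq {W : Type (max v w)} [NormedAddCommGroup W]
    [NormedSpace ℝ W] {ρ : NormedAction K W} (h : IsRelativelyInjective (dualAction ρ)) {i : ℕ}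
    (f : Cochain K (StrongDual ℝ W) (i + 1)) (hf : delta (dualAction ρ) (i + 1) f = 0) :
    ∃ b, delta (dualAction ρ) i b = f := by
  have hj := isEquivariant_dualMap_action ρ
  -- Extending the identity of W' along W' → I, with left inverse `evalOne`, makes W' an equivariant
  -- retract of I.
  obtain ⟨β, hβ, hβj, -⟩ := h _ _ (dualAction ρ) (dualAction (FinL1.translation K W))
    (dualMap (FinL1.action ρ)) (evalOne K W) (.id ℝ _) hj norm_evalOne_le
    (ContinuousLinearMap.ext (evalOne_dualMap_action ρ)) fun _ _ => rfl
  obtain ⟨c, hc⟩ := exists_delta_eq_translation (f.postcomp (dualMap (FinL1.action ρ))) (by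
    rw [delta_postcomp hj, hf, Cochain.postcomp_zero])
  refine ⟨c.postcomp β, ?_⟩
  rw [delta_postcomp hβ, hc]
  exact Cochain.ext fun x => congrArg (fun T => T (f x)) hβj

/-- Transfers vanishing to ℝ from the dual of a universe-lifted ℝ, through mutually inverse
identifications. -/
theorem exists_delta_eq_real {G : Type u} [Group G] {i : ℕ}
    (h : ∀ z : Cochain G (StrongDual ℝ (ULift.{w} ℝ)) (i + 1), delta 1 (i + 1) z = 0 →
      ∃ b, delta (1 : NormedAction G (StrongDual ℝ (ULift.{w} ℝ))) i b = z)
    (z : Cochain G ℝ (i + 1)) (hz : delta 1 (i + 1) z = 0) :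
    ∃ b, delta (1 : NormedAction G ℝ) i b = z := by
  let e : StrongDual ℝ (ULift.{w} ℝ) := (ContinuousLinearEquiv.ulift : ULift.{w} ℝ ≃L[ℝ] ℝ)
  let S : ℝ →L[ℝ] StrongDual ℝ (ULift.{w} ℝ) := (ContinuousLinearMap.id ℝ ℝ).smulRight e
  let T : StrongDual ℝ (ULift.{w} ℝ) →L[ℝ] ℝ := ContinuousLinearMap.apply ℝ ℝ (ULift.up 1)
  have hS : IsEquivariant (1 : NormedAction G ℝ) (1 : NormedAction G (StrongDual ℝ (ULift.{w} ℝ))) S := fun _ _ => rfl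
  have hT : IsEquivariant (1 : NormedAction G (StrongDual ℝ (ULift.{w} ℝ))) (1 : NormedAction G ℝ)
      T := fun _ _ => rfl
  obtain ⟨b, hb⟩ := h (z.postcomp S) (by rw [delta_postcomp hS, hz, Cochain.postcomp_zero])
  refine ⟨b.postcomp T, ?_⟩
  rw [delta_postcomp hT, hb]
  exact Cochain.ext fun x => mul_one (z x)

end Characterization

end

end BoundedCohomology

/-! ### The main theorem -/

open BoundedCohomology in
-- For n = ∞ the separate injectivity clause of (1) is vacuous, since no natural number equals ∞ +
-- 1.
theorem mainTheorem2 {Γ : Type u} {K : Type v} [Group Γ] [Group K] (φ : Γ →* K) (n : ℕ∞) :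
    List.TFAE [
      (∀ (W : Type (max v w)) [NormedAddCommGroup W] [NormedSpace ℝ W] (ρ : NormedAction K W),
        (∀ i : ℕ, (i : ℕ∞) ≤ n → Function.Bijective (cohomologyMap φ (dualAction ρ) i)) ∧
        (∀ i : ℕ, (i : ℕ∞) = n + 1 → Function.Injective (cohomologyMap φ (dualAction ρ) i))),
      (∀ (W : Type (max v w)) [NormedAddCommGroup W] [NormedSpace ℝ W] (ρ : NormedAction K W),
        ∀ i : ℕ, (i : ℕ∞) ≤ n → Function.Surjective (cohomologyMap φ (dualAction ρ) i)),
      (Function.Surjective φ ∧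
        ∀ (W : Type (max v w)) [NormedAddCommGroup W] [NormedSpace ℝ W] (ρ : NormedAction K W),
          IsRelativelyInjective (dualAction ρ) →
          ∀ i : ℕ, 1 ≤ i → (i : ℕ∞) ≤ n →
            Subsingleton (Cohomology (restrict φ (dualAction ρ)) i)),
      (Function.Surjective φ ∧ IsBoundedlyAcyclic φ.ker n)] := by
  tfae_have 1 → 2 := fun h W _ _ ρ i hi => ((h W ρ).1 i hi).2
  tfae_have 2 → 3 := by
    intro h
    refine ⟨surjective_of_restrictionSurjective_zero (W := ULift.{max v w} ℝ)
      ((restrictionSurjective_iff _ _ _).1 (h _ _ 0 (by simp))), fun W _ _ ρ hρ i hi hin => ?_⟩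
    obtain ⟨i, rfl⟩ := Nat.exists_eq_add_of_le' hi
    have : Subsingleton (Cohomology (dualAction ρ) (i + 1)) :=
      (subsingleton_cohomology_succ_iff _ _).2
        (IsRelativelyInjective.exists_delta_eq.{v, max v w} hρ)
    -- The source of the surjective restriction map is zero, hence so is its target.
    exact (h W ρ (i + 1) hin).subsingleton
  tfae_have 3 → 4 := by
    rintro ⟨hφ, h⟩
    refine ⟨hφ, fun i hi hin => ?_⟩
    obtain ⟨i, rfl⟩ := Nat.exists_eq_add_of_le' hi
    refine (subsingleton_cohomology_succ_iff _ _).2 (exists_delta_eq_real.{u, max v w}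
      (exists_delta_eq_ker hφ i ((subsingleton_cohomology_succ_iff _ _).1 ?_)))
    exact h _ _ FinL1.isRelativelyInjective_dualAction_translation (i + 1) hi hin
  tfae_have 4 → 1 := by
    rintro ⟨hφ, h⟩ W _ _ ρ
    refine ⟨fun i hi => ⟨?_, ?_⟩, fun i hi => ?_⟩
    · exact (restrictionInjective_iff _ _ _).2
        (h.restrictionInjective.{u, v, max v w} hφ i (hi.trans le_self_add) W ρ)
    · exact (restrictionSurjective_iff _ _ _).2
        (h.restrictionSurjective.{u, v, max v w} hφ i hi W ρ)
    · exact (restrictionInjective_iff _ _ _).2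
        (h.restrictionInjective.{u, v, max v w} hφ i hi.le W ρ)
  tfae_finish
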